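/- **Setting.** Let $\Omega\subseteq\mathbb{R}^n$ be open, $m\ge 1$ an integer, $p\in[1,\infty)$ and $D\subseteq\mathbb{R}^n$ bounded and open. Let $|\cdot|_2$ denote the Euclidean norm and, on matrices $\mathbb{R}^{m\times n}$, the induced operator norm. For $\varepsilon>0$ let $\Gamma_\varepsilon$ be the set of maps $x\mapsto \varepsilon x+h$, $h\in\mathbb{R}^n$, let $\Gamma=\bigcup_{\varepsilon>0}\Gamma_\varepsilon$, and let $\mathcal{G}^D_\varepsilon(\Omega)=\{F(D):F\in\Gamma_\varepsilon,\ F(D)\subseteq\Omega\}$, $\mathcal{G}^D(\mathbb{R}^n)=\{F(D):F\in\Gamma\}$ (this is the case $\mathcal{G}=\{\mathrm{id}\}$ of the rotation group). For a linear map $\mathfrak{L}:\mathbb{R}^{m\times n}\to\mathbb{R}^{m\times n}$, an open set $U$ and $u\in L^1_{\rm loc}(U;\mathbb{R}^m)$, let $D_{\mathfrak{L}}u$ be the matrix of distributions $\langle (D_{\mathfrak{L}}u)_{ij},\phi\rangle=-\int_U \mathfrak{L}(u\otimes\nabla\phi)_{ij}\,dx$, $\phi\in C_c^\infty(U)$;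 when it is represented by a locally integrable function, that function is denoted in the same way. Let $W^{\mathfrak{L},p}(U;\mathbb{R}^m)$ (resp. $W^{\mathfrak{L},p}_{\rm loc}$) be the set of $u\in L^p$ (resp. $L^p_{\rm loc}$) with $D_{\mathfrak{L}}u\in L^p$ (resp. $L^p_{\rm loc}$). For $\mathfrak{L}=\mathrm{id}$ these are the Sobolev spaces $W^{1,p}$, $W^{1,p}_{\rm loc}$, and $D_{\mathfrak L}=\nabla$. A *$p$-core functional* is a map $\alpha_p: L^p_{\rm loc}(\mathbb{R}^n;\mathbb{R}^m)\times\mathcal{G}^D(\mathbb{R}^n)\to[0,\infty)$ such that, for all $u,v\in L^p_{\rm loc}(\mathbb{R}^n;\mathbb{R}^m)$ and $D'\in\mathcal{G}^D(\mathbb{R}^n)$: $\alpha_p(u,D')=\alpha_p(v,D')$ if $u=v$ a.e. on $D'$; $\alpha_p(\cdot,D')$ is convex; $\alpha_p(tu,D')=|t|^p\alpha_p(u,D')$ for $t\in\mathbb{R}$; $\alpha_p(u+h,D')=\alpha_p(u,D')$ for $h\in\mathbb{R}^m$; $\alpha_p(u\circ F,D')=\alpha_p(u,F(D'))$ for $F\in\Gamma$;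 and there is $c_1>0$ with $\alpha_p(u,D)\le c_1\int_D|\nabla u|_2^p\,dx$ for all $u\in L^p_{\rm loc}(\mathbb{R}^n;\mathbb{R}^m)$ with $u|_D\in W^{1,p}(D;\mathbb{R}^m)$. For an open set $U$ and $u\in L^p_{\rm loc}(\mathbb{R}^n;\mathbb{R}^m)$ put $$G^{\alpha_p}_\varepsilon(u,U)=\varepsilon^{n-p}\sup_{\mathcal{G}_\varepsilon}\sum_{D'\in\mathcal{G}_\varepsilon}\alpha_p(u,D')\in[0,\infty],$$ the supremum being over all families $\mathcal{G}_\varepsilon$ of pairwise disjoint elements of $\mathcal{G}^D_\varepsilon(U)$, and $\psi_{\alpha_p}(A)=\lim_{\varepsilon\to0^+}G^{\alpha_p}_\varepsilon(l^A,(-\tfrac12,\tfrac12)^n)$ for $A\in\mathbb{R}^{m\times n}$, where $l^A(x)=Ax$. The set $\mathcal{N}_{\psi_{\alpha_p}}=\{A:\psi_{\alpha_p}(A)=0\}$ is a linear subspace of $\mathbb{R}^{m\times n}$. For a linear subspace $\mathcal{P}$ with $\mathbb{R}^{m\times n}=\mathcal{P}\oplus\mathcal{N}_{\psi_{\alpha_p}}$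 let $\pi_{\mathcal{P}}$ be the projection onto $\mathcal{P}$ along $\mathcal{N}_{\psi_{\alpha_p}}$. The functional $\alpha_p$ is a *strong $p$-core functional* if for some such $\mathcal{P}$ there is $c_3>0$ with $\alpha_p(u,D)\le c_3\int_D|D_{\pi_{\mathcal{P}}}u|_2^p\,dx$ for all $u\in L^p_{\rm loc}(\mathbb{R}^n;\mathbb{R}^m)$ with $u|_D\in W^{\pi_{\mathcal{P}},p}(D;\mathbb{R}^m)$. **Theorem.** Let $\alpha_p$ be a strong $p$-core functional, let $\mathcal{P}$ be a linear subspace with $\mathbb{R}^{m\times n}=\mathcal{P}\oplus\mathcal{N}_{\psi_{\alpha_p}}$, and let $u\in L^p_{\rm loc}(\mathbb{R}^n;\mathbb{R}^m)$. The limit defining $\psi_{\alpha_p}(A)$ exists and is finite for every $A\in\mathbb{R}^{m\times n}$. If $D_{\pi_{\mathcal{P}}}(u|_\Omega)\in L^p(\Omega;\mathbb{R}^{m\times n})$, then $$\lim_{\varepsilon\to0^+}G^{\alpha_p}_\varepsilon(u,\Omega)=\int_\Omega\psi_{\alpha_p}\big(D_{\pi_{\mathcal{P}}}(u|_\Omega)\big)\,dx.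 \tag{$*$}$$ Moreover, if $u|_\Omega\in W^{\pi_{\mathcal{P}},p}_{\rm loc}(\Omega;\mathbb{R}^m)$ and $\psi_{\alpha_p}\not\equiv0$, then $(*)$ still holds, both sides being possibly $+\infty$. -/

import Mathlib

open MeasureTheory Filter Topology Set
open scoped ENNReal NNReal

noncomputable section

namespace BMOType

/-- The Euclidean space `ℝᵏ`. -/
abbrev Euc (k : ℕ) : Type := EuclideanSpace ℝ (Fin k)

/-- The space of real `m × n` matrices, each identified with the linear map `l^A : x ↦ A x`.
The norm is the operator norm `|A|₂` with respect to the Euclidean norms. -/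
abbrev Mat (m n : ℕ) : Type := Euc n →L[ℝ] Euc m

/-- The group `Aff(ℝⁿ)` of invertible affine transformations of `ℝⁿ`. -/
abbrev Aff (n : ℕ) : Type := Euc n ≃ᵃ[ℝ] Euc n

/-- The open unit cube `(-1/2, 1/2)ⁿ`. -/
def unitCube (n : ℕ) : Set (Euc n) := {x | ∀ i, x i ∈ Ioo (-(1 / 2) : ℝ) (1 / 2)}

/-! ### Local Lebesgue spaces and Sobolev-type spaces -/

/-- `f ∈ L^p_loc(Ω; F)`: `f` is in `L^p(K; F)` for every compact `K ⊆ Ω`. -/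
def LpLoc {n : ℕ} {F : Type*} [NormedAddCommGroup F] (p : ℝ) (Ω : Set (Euc n))
    (f : Euc n → F) : Prop :=
  ∀ K : Set (Euc n), IsCompact K → K ⊆ Ω → MemLp f (ENNReal.ofReal p) (volume.restrict K)

/-- `f ∈ L^p(Ω; F)`. -/
def LpOn {n : ℕ} {F : Type*} [NormedAddCommGroup F] (p : ℝ) (Ω : Set (Euc n))
    (f : Euc n → F) : Prop :=
  MemLp f (ENNReal.ofReal p) (volume.restrict Ω)

/-- The matrix of distributions `D_L (u|_Ω)` is represented by the function `g`:
`∫_Ω φ g = - ∫_Ω L(u ⊗ ∇φ)` for every test function `φ ∈ C_c^∞(Ω)`.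
The matrix `u(x) ⊗ ∇φ(x)` is the linear map `v ↦ (∇φ(x) · v) u(x)`. -/
structure IsDistribD {m n : ℕ} (L : Mat m n →ₗ[ℝ] Mat m n) (Ω : Set (Euc n))
    (u : Euc n → Euc m) (g : Euc n → Mat m n) : Prop where
  locallyIntegrable_fun : LocallyIntegrableOn u Ω
  locallyIntegrable_deriv : LocallyIntegrableOn g Ω
  integral_eq : ∀ φ : Euc n → ℝ, ContDiff ℝ (⊤ : ℕ∞) φ → HasCompactSupport φ → tsupport φ ⊆ Ω →
    ∫ x in Ω, φ x • g x = - ∫ x in Ω, L ((fderiv ℝ φ x).smulRight (u x))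

/-- `u|_Ω ∈ W^{L,p}(Ω; ℝᵐ)`, with `D_L (u|_Ω) = g`. -/
structure IsWLp {m n : ℕ} (L : Mat m n →ₗ[ℝ] Mat m n) (p : ℝ) (Ω : Set (Euc n))
    (u : Euc n → Euc m) (g : Euc n → Mat m n) : Prop where
  memLp_fun : LpOn p Ω u
  memLp_deriv : LpOn p Ω g
  isDistribD : IsDistribD L Ω u g

/-- `u|_Ω ∈ W^{L,p}_loc(Ω; ℝᵐ)`, with `D_L (u|_Ω) = g`. -/
structure IsWLpLoc {m n : ℕ} (L : Mat m n →ₗ[ℝ] Mat m n) (p : ℝ) (Ω : Set (Euc n))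
    (u : Euc n → Euc m) (g : Euc n → Mat m n) : Prop where
  lpLoc_fun : LpLoc p Ω u
  lpLoc_deriv : LpLoc p Ω g
  isDistribD : IsDistribD L Ω u g

/-! ### The transformed copies of the reference set -/

/-- The class of all subsets of `Ω` of the form `F(D)`, with `F ∈ Γ`. -/
def copies {n : ℕ} (Γ : Set (Aff n)) (D Ω : Set (Euc n)) : Set (Set (Euc n)) :=
  {D' | (∃ F ∈ Γ, D' = F '' D) ∧ D' ⊆ Ω}

/-- `Γ^𝒢_ε`: the maps `x ↦ ε R x + h`, with `R ∈ 𝒢` and `h ∈ ℝⁿ`, where `𝒢` is a group of linear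
isometries of `ℝⁿ`. -/
def gammaEps {n : ℕ} (𝒢 : Subgroup (Euc n ≃ₗᵢ[ℝ] Euc n)) (ε : ℝ) : Set (Aff n) :=
  {F | ∃ R ∈ 𝒢, ∃ h : Euc n, ∀ x, F x = ε • R x + h}

/-- `Γ^𝒢`, the union of the `Γ^𝒢_ε` over all `ε > 0`, as a subgroup of `Aff(ℝⁿ)`. -/
def gammaGroup {n : ℕ} (𝒢 : Subgroup (Euc n ≃ₗᵢ[ℝ] Euc n)) : Subgroup (Aff n) where
  carrier := {F | ∃ ε : ℝ, 0 < ε ∧ F ∈ gammaEps 𝒢 ε}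
  one_mem' := ⟨1, one_pos, 1, 𝒢.one_mem, 0, fun x => by simp⟩
  mul_mem' := by
    rintro F G ⟨ε, hε, R, hR, h, hF⟩ ⟨δ, hδ, S, hS, k, hG⟩
    refine ⟨ε * δ, mul_pos hε hδ, R * S, 𝒢.mul_mem hR hS, ε • R k + h, fun x => ?_⟩
    rw [AffineEquiv.mul_def, AffineEquiv.trans_apply, hF, hG]
    simp [smul_add, mul_smul, add_assoc]
  inv_mem' := by
    rintro F ⟨ε, hε, R, hR, h, hF⟩
    refine ⟨ε⁻¹, inv_pos.mpr hε, R⁻¹, 𝒢.inv_mem hR, -(ε⁻¹ • R⁻¹ h), fun x => ?_⟩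
    rw [AffineEquiv.inv_def, AffineEquiv.symm_apply_eq, hF]
    simp [smul_smul, hε.ne']

/-! ### `p`-core functionals -/

/-- `α` is a `p`-core functional with reference set `D`, subordinated to the subgroup `Γ` of
`Aff(ℝⁿ)`. Its domain is `L^p_loc(ℝⁿ; ℝᵐ) × {F(D) : F ∈ Γ}`: the values of `α` elsewhere play no
role, and by `ext_indep` the value `α u D'` depends only on the a.e. class of `u` on `D'`. -/
structure IsPCore {m n : ℕ} (p : ℝ) (D : Set (Euc n)) (Γ : Subgroup (Aff n))
    (α : (Euc n → Euc m) → Set (Euc n) → ℝ≥0) : Prop where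
  one_le : 1 ≤ p
  isOpen_ref : IsOpen D
  isBounded_ref : Bornology.IsBounded D
  ext_indep : ∀ D' ∈ copies (Γ : Set (Aff n)) D univ, ∀ u v, LpLoc p univ u → LpLoc p univ v →
    u =ᵐ[volume.restrict D'] v → α u D' = α v D'
  convex : ∀ D' ∈ copies (Γ : Set (Aff n)) D univ, ∀ u v, LpLoc p univ u → LpLoc p univ v →
    ∀ t : ℝ, 0 ≤ t → t ≤ 1 →
      (α (t • u + (1 - t) • v) D' : ℝ) ≤ t * α u D' + (1 - t) * α v D'
  homogeneous : ∀ D' ∈ copies (Γ : Set (Aff n)) D univ, ∀ u, LpLoc p univ u → ∀ t : ℝ,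
    (α (t • u) D' : ℝ) = |t| ^ p * α u D'
  add_const : ∀ D' ∈ copies (Γ : Set (Aff n)) D univ, ∀ u, LpLoc p univ u → ∀ h : Euc m,
    α (fun x => u x + h) D' = α u D'
  change_var : ∀ D' ∈ copies (Γ : Set (Aff n)) D univ, ∀ u, LpLoc p univ u → ∀ F ∈ Γ,
    α (u ∘ F) D' = α u (F '' D')
  grad_bound : ∃ c : ℝ≥0, 0 < c ∧ ∀ u g, LpLoc p univ u → IsWLp LinearMap.id p D u g →
    (α u D : ℝ≥0∞) ≤ c * ∫⁻ x in D, ‖g x‖ₑ ^ p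

/-- The BMO-type seminorm `G_ε(u, Ω) = ε^{n-p} sup ∑_{D'} α(u, D')`, the supremum being over all
families of pairwise disjoint sets `D' = F(D) ⊆ Ω` with `F ∈ Γ^𝒢_ε`. It takes values in `[0,∞]`. -/
def bmoG {m n : ℕ} (p : ℝ) (D : Set (Euc n)) (𝒢 : Subgroup (Euc n ≃ₗᵢ[ℝ] Euc n))
    (α : (Euc n → Euc m) → Set (Euc n) → ℝ≥0) (ε : ℝ) (u : Euc n → Euc m) (Ω : Set (Euc n)) :
    ℝ≥0∞ :=
  ENNReal.ofReal (ε ^ ((n : ℝ) - p)) *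
    ⨆ (𝒮 : Set (Set (Euc n))) (_ : 𝒮 ⊆ copies (gammaEps 𝒢 ε) D Ω) (_ : 𝒮.PairwiseDisjoint id),
      ∑' D' : 𝒮, (α u D' : ℝ≥0∞)

/-- `ψ_α(A) = lim_{ε → 0⁺} G_ε(l^A, Q)`, where `Q` is the open unit cube. The limit is written as
an upper limit so that `ψ_α` is defined without knowing beforehand that the limit exists. -/
def psi {m n : ℕ} (p : ℝ) (D : Set (Euc n)) (𝒢 : Subgroup (Euc n ≃ₗᵢ[ℝ] Euc n))
    (α : (Euc n → Euc m) → Set (Euc n) → ℝ≥0) (A : Mat m n) : ℝ≥0∞ :=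
  limsup (fun ε : ℝ => bmoG p D 𝒢 α ε (fun x => A x) (unitCube n)) (𝓝[>] 0)

theorem lpLoc_mat {m n : ℕ} (p : ℝ) (A : Mat m n) :
    LpLoc p (univ : Set (Euc n)) (fun x => A x) := by
  intro K hK _
  obtain ⟨C, hC⟩ := hK.exists_bound_of_continuousOn A.continuous.continuousOn
  have : IsFiniteMeasure (volume.restrict K) := ⟨by simpa using hK.measure_lt_top⟩
  exact MemLp.of_bound A.continuous.aestronglyMeasurable C
    ((ae_restrict_iff' hK.measurableSet).2 (Eventually.of_forall hC))

theorem bmoG_mat_le {m n : ℕ} {p : ℝ} {D : Set (Euc n)} {𝒢 : Subgroup (Euc n ≃ₗᵢ[ℝ] Euc n)}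
    {α : (Euc n → Euc m) → Set (Euc n) → ℝ≥0} (a b : ℝ≥0) (A B C : Mat m n)
    (h : ∀ D' ∈ copies (gammaGroup 𝒢 : Set (Aff n)) D univ,
      α (fun x => C x) D' ≤ a * α (fun x => A x) D' + b * α (fun x => B x) D')
    {ε : ℝ} (hε : 0 < ε) (Ω : Set (Euc n)) :
    bmoG p D 𝒢 α ε (fun x => C x) Ω ≤
      a * bmoG p D 𝒢 α ε (fun x => A x) Ω + b * bmoG p D 𝒢 α ε (fun x => B x) Ω := by
  unfold bmoG
  rw [mul_left_comm, mul_left_comm (b : ℝ≥0∞), ← mul_add]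
  gcongr
  refine iSup_le fun 𝒮 => iSup_le fun h1 => iSup_le fun h2 => ?_
  have key : ∀ w : Euc n → Euc m, ∑' D' : 𝒮, (α w D' : ℝ≥0∞) ≤
      ⨆ (𝒮 : Set (Set (Euc n))) (_ : 𝒮 ⊆ copies (gammaEps 𝒢 ε) D Ω)
        (_ : 𝒮.PairwiseDisjoint id), ∑' D' : 𝒮, (α w D' : ℝ≥0∞) := fun w =>
    le_iSup_of_le 𝒮 (le_iSup_of_le h1 (le_iSup_of_le h2 le_rfl))
  calc ∑' D' : 𝒮, (α (fun x => C x) D' : ℝ≥0∞)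
      ≤ ∑' D' : 𝒮, ((a : ℝ≥0∞) * α (fun x => A x) D' + b * α (fun x => B x) D') := by
        refine ENNReal.tsum_le_tsum fun D' => ?_
        obtain ⟨⟨F, hF, hD⟩, -⟩ := h1 D'.2
        exact_mod_cast h D' ⟨⟨F, ⟨ε, hε, hF⟩, hD⟩, subset_univ _⟩
    _ = a * ∑' D' : 𝒮, (α (fun x => A x) D' : ℝ≥0∞)
          + b * ∑' D' : 𝒮, (α (fun x => B x) D' : ℝ≥0∞) := by
        rw [ENNReal.tsum_add, ENNReal.tsum_mul_left, ENNReal.tsum_mul_left]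
    _ ≤ _ := by gcongr <;> exact key _

theorem psi_eq_zero_iff {m n : ℕ} {p : ℝ} {D : Set (Euc n)} {𝒢 : Subgroup (Euc n ≃ₗᵢ[ℝ] Euc n)}
    {α : (Euc n → Euc m) → Set (Euc n) → ℝ≥0} {A : Mat m n} :
    psi p D 𝒢 α A = 0 ↔
      Tendsto (fun ε : ℝ => bmoG p D 𝒢 α ε (fun x => A x) (unitCube n)) (𝓝[>] 0) (𝓝 0) :=
  ⟨fun h => tendsto_of_le_liminf_of_limsup_le bot_le h.le, fun h => h.limsup_eq⟩

theorem psi_eq_zero_of_le {m n : ℕ} {p : ℝ} {D : Set (Euc n)}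
    {𝒢 : Subgroup (Euc n ≃ₗᵢ[ℝ] Euc n)} {α : (Euc n → Euc m) → Set (Euc n) → ℝ≥0}
    (a b : ℝ≥0) (A B C : Mat m n)
    (h : ∀ D' ∈ copies (gammaGroup 𝒢 : Set (Aff n)) D univ,
      α (fun x => C x) D' ≤ a * α (fun x => A x) D' + b * α (fun x => B x) D')
    (hA : psi p D 𝒢 α A = 0) (hB : psi p D 𝒢 α B = 0) : psi p D 𝒢 α C = 0 := by
  rw [psi_eq_zero_iff] at *
  have hlim := (ENNReal.Tendsto.const_mul (a := (a : ℝ≥0∞)) hA (Or.inr ENNReal.coe_ne_top)).add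
    (ENNReal.Tendsto.const_mul (a := (b : ℝ≥0∞)) hB (Or.inr ENNReal.coe_ne_top))
  simp only [mul_zero, add_zero] at hlim
  refine tendsto_of_tendsto_of_tendsto_of_le_of_le' tendsto_const_nhds hlim
    (Eventually.of_forall fun _ => bot_le) ?_
  filter_upwards [self_mem_nhdsWithin] with ε hε
  exact bmoG_mat_le a b A B C h hε _

theorem IsPCore.smul_mat {m n : ℕ} {p : ℝ} {D : Set (Euc n)} {Γ : Subgroup (Aff n)}
    {α : (Euc n → Euc m) → Set (Euc n) → ℝ≥0} (hα : IsPCore p D Γ α) (t : ℝ) (A : Mat m n)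
    {D' : Set (Euc n)} (hD' : D' ∈ copies (Γ : Set (Aff n)) D univ) :
    α (fun x => (t • A) x) D' = (Real.nnabs t) ^ p * α (fun x => A x) D' := by
  have := hα.homogeneous D' hD' _ (lpLoc_mat p A) t
  refine NNReal.eq ?_
  rw [NNReal.coe_mul, NNReal.coe_rpow, Real.coe_nnabs]
  exact this

/-- The null set `𝒩_ψ = {A : ψ_α(A) = 0}`, which is a linear subspace of the space of matrices. -/
def IsPCore.nullSpace {m n : ℕ} {p : ℝ} {D : Set (Euc n)} {𝒢 : Subgroup (Euc n ≃ₗᵢ[ℝ] Euc n)}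
    {α : (Euc n → Euc m) → Set (Euc n) → ℝ≥0} (hα : IsPCore p D (gammaGroup 𝒢) α) :
    Submodule ℝ (Mat m n) where
  carrier := {A | psi p D 𝒢 α A = 0}
  zero_mem' := by
    have hp : p ≠ 0 := (zero_lt_one.trans_le hα.one_le).ne'
    have h0 : ∀ D' ∈ copies (gammaGroup 𝒢 : Set (Aff n)) D univ,
        α (fun x => (0 : Mat m n) x) D' = 0 := fun D' hD' => by
      have := hα.smul_mat 0 (0 : Mat m n) hD'
      have hz : (0 : ℝ) • (0 : Mat m n) = 0 := by ext1 x; simp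
      rw [hz] at this
      rw [this, map_zero, NNReal.zero_rpow hp, zero_mul]
    have hle : ∀ ε : ℝ, 0 < ε →
        bmoG p D 𝒢 α ε (fun x => (0 : Mat m n) x) (unitCube n) = 0 := fun ε hε => by
      have := bmoG_mat_le (p := p) (α := α) 0 0 0 0 (0 : Mat m n)
        (fun D' hD' => (h0 D' hD').le.trans bot_le) hε (unitCube n)
      simpa only [ENNReal.coe_zero, zero_mul, add_zero, nonpos_iff_eq_zero] using this
    refine psi_eq_zero_iff.2 (tendsto_const_nhds.congr' ?_)
    filter_upwards [self_mem_nhdsWithin] with ε hε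
    exact (hle ε hε).symm
  add_mem' := by
    intro A B hA hB
    have hp := hα.one_le
    refine psi_eq_zero_of_le (2 ^ p * 2⁻¹) (2 ^ p * 2⁻¹) A B (A + B) (fun D' hD' => ?_) hA hB
    have hc := hα.convex D' hD' _ _ (lpLoc_mat p A) (lpLoc_mat p B) (1 / 2) (by norm_num)
      (by norm_num)
    have he : (fun x => (A + B) x) =
        fun x => ((2 : ℝ) • (((1 : ℝ) / 2) • A + (1 - (1 : ℝ) / 2) • B)) x := by
      ext1 x
      have h1 : (2 : ℝ) * (1 - 2⁻¹) = 1 := by norm_num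
      simp [smul_add, smul_smul, h1]
    rw [he, hα.smul_mat _ _ hD', ← NNReal.coe_le_coe]
    have h2 : (0 : ℝ) ≤ 2 ^ p := by positivity
    have := mul_le_mul_of_nonneg_left hc h2
    push_cast
    simp only [abs_two]
    refine le_trans (le_of_eq ?_) (this.trans (le_of_eq ?_))
    · rfl
    · ring
  smul_mem' := by
    intro t A hA
    exact psi_eq_zero_of_le ((Real.nnabs t) ^ p) 0 A A (t • A)
      (fun D' hD' => by rw [hα.smul_mat t A hD']; simp) hA hA

/-- `α` is a strong `p`-core functional, subordinated to `Γ^𝒢`: for some linear subspace `P` with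
`ℝ^{m×n} = P ⊕ 𝒩_ψ`, and with `π_P` the projection onto `P` along `𝒩_ψ`, the value `α(u, D)` is
bounded by a constant times the `p`-th power of the `L^p(D)` norm of `D_{π_P} u`. -/
structure IsStrongPCore {m n : ℕ} (p : ℝ) (D : Set (Euc n)) (𝒢 : Subgroup (Euc n ≃ₗᵢ[ℝ] Euc n))
    (α : (Euc n → Euc m) → Set (Euc n) → ℝ≥0) : Prop where
  isPCore : IsPCore p D (gammaGroup 𝒢) α
  proj_bound : ∃ (P : Submodule ℝ (Mat m n)) (hP : IsCompl P isPCore.nullSpace) (c : ℝ≥0), 0 < c ∧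
    ∀ u g, LpLoc p univ u → IsWLp (P.projection isPCore.nullSpace hP) p D u g →
      (α u D : ℝ≥0∞) ≤ c * ∫⁻ x in D, ‖g x‖ₑ ^ p

end BMOType

end

/-!
The group of rotations is trivial, so all copies of `D` are of the form `εD + x`, and on a linear
map `α(l^A, εD + x) = ε^p α(l^A, D)`. Hence for linear maps the seminorm `G_ε` only counts how many
disjoint copies of `εD` fit into a set, and everything reduces to a packing problem plus a
perturbation argument.

*Packing.* Let `κ` be the packing constant of `D`, and let `f ≥ 0` be continuous with compact
support. The maximum of `εⁿ ∑ f x` over the centres of disjoint copies `εD + x` tends to `κ ∫ f`.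
With `κ` defined by duality (`packConst`), the lower bound `packConst_mul_lintegral_le` is a
rescaling of the definition, and the upper bound `eventually_packSum_le` follows by replacing `f`
with its convolution with a rescaled, almost optimal density, which changes `f` little.

*Perturbation.* Convexity and homogeneity give `α(v) ≤ θ α(w) + C_θ α(v - w)` with `θ > 1`
arbitrarily close to `1` (`IsPCore.exists_le_add`). The bound in the definition of a strong core
functional, which does not depend on the complement `P` (`IsStrongPCore.exists_bound`), and a
change of variables show, for `g = D_π u` and `A ∈ P`, that `ε^{n-p} α(u, εD + x)` and
`εⁿ α(l^A, D)` bound each other up to the factor `θ` and an error `C ∫_{εD + x} |g - A|^p`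
(`IsPCore.compare_copy`). The
field `g` takes its values in `P` a.e., so it is approximated in `L^p(Ω)` by `f ∈ C_c(Ω; P)`; taking
`A = f x`, the errors sum up to a multiple of `‖g - f‖_p^p` plus the oscillation of `f` at scale
`ε`, and the main term is a packing sum. This gives `G_ε(u, Ω) → κ ∫_Ω α(l^{g(x)}, D) dx`
(`IsStrongPCore.tendsto_bmoG`). No Poincaré inequality or regularity of `u` is needed.

*Conclusion.* The case `u = l^A`, `Ω` the unit cube, identifies `ψ_α(A) = κ α(l^{π A}, D)`. As `ψ_α`
is continuous, `p`-homogeneous and positive on `P \ {0}`, it dominates `|A|^p` there, so for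
`D_π u ∈ L^p_loc(Ω)` either `D_π u ∈ L^p(Ω)` or both sides are infinite.
-/

noncomputable section

namespace BMOType

variable {n m : ℕ} {p : ℝ} {D Ω : Set (Euc n)} {α : (Euc n → Euc m) → Set (Euc n) → ℝ≥0}

/-! ### Dilations -/

theorem measurableEmbedding_dilate {ε : ℝ} (hε : ε ≠ 0) (x : Euc n) :
    MeasurableEmbedding (fun z : Euc n => ε • z + x) :=
  (measurableEmbedding_addRight x).comp (measurableEmbedding_const_smul₀ hε)

theorem map_dilate {ε : ℝ} (hε : 0 < ε) (x : Euc n) :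
    Measure.map (fun z : Euc n => ε • z + x) volume = ENNReal.ofReal ((ε ^ n)⁻¹) • volume := by
  have h : (fun z : Euc n => ε • z + x) = (fun z => z + x) ∘ (fun z => ε • z) := rfl
  rw [h, ← Measure.map_map (by fun_prop) (by fun_prop), Measure.map_addHaar_smul _ hε.ne',
    Measure.map_smul, map_add_right_eq_self, finrank_euclideanSpace_fin,
    abs_of_pos (by positivity)]

theorem ofReal_pow_mul_inv {ε : ℝ} (hε : 0 < ε) (k : ℕ) :
    ENNReal.ofReal (ε ^ k) * ENNReal.ofReal ((ε ^ k)⁻¹) = 1 := by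
  rw [← ENNReal.ofReal_mul (by positivity), mul_inv_cancel₀ (by positivity), ENNReal.ofReal_one]

theorem lintegral_dilate {ε : ℝ} (hε : 0 < ε) (x : Euc n) (f : Euc n → ℝ≥0∞) :
    ENNReal.ofReal (ε ^ n) * ∫⁻ y, f (ε • y + x) = ∫⁻ y, f y := by
  rw [← (measurableEmbedding_dilate hε.ne' x).lintegral_map, map_dilate hε,
    lintegral_smul_measure, smul_eq_mul, ← mul_assoc, ofReal_pow_mul_inv hε, one_mul]

/-- The copy `εD + x` of the reference set `D`. -/
def copy (D : Set (Euc n)) (ε : ℝ) (x : Euc n) : Set (Euc n) := (fun z => ε • z + x) '' D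

theorem map_dilate_restrict {ε : ℝ} (hε : 0 < ε) (x : Euc n) (D : Set (Euc n)) :
    Measure.map (fun z : Euc n => ε • z + x) (volume.restrict D) =
      ENNReal.ofReal ((ε ^ n)⁻¹) • volume.restrict (copy D ε x) := by
  have he := measurableEmbedding_dilate hε.ne' x
  rw [← Measure.restrict_smul, ← map_dilate hε x, he.restrict_map, copy,
    preimage_image_eq _ he.injective]

theorem setLIntegral_dilate {ε : ℝ} (hε : 0 < ε) (x : Euc n) (D : Set (Euc n))
    (f : Euc n → ℝ≥0∞) :
    ENNReal.ofReal (ε ^ n) * ∫⁻ y in D, f (ε • y + x) = ∫⁻ y in copy D ε x, f y := by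
  have he := measurableEmbedding_dilate hε.ne' x
  rw [← he.lintegral_map, map_dilate_restrict hε, lintegral_smul_measure, smul_eq_mul, ← mul_assoc,
    ofReal_pow_mul_inv hε, one_mul]

theorem volume_copy {ε : ℝ} (hε : 0 < ε) (x : Euc n) (D : Set (Euc n)) :
    volume (copy D ε x) = ENNReal.ofReal (ε ^ n) * volume D := by
  simpa using (setLIntegral_dilate hε x D 1).symm

theorem isOpen_copy {D : Set (Euc n)} (hD : IsOpen D) {ε : ℝ} (hε : ε ≠ 0) (x : Euc n) :
    IsOpen (copy D ε x) :=
  ((isOpenMap_add_right x).comp (isOpenMap_smul₀ hε)) D hD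

theorem copy_subset_closedBall {D : Set (Euc n)} {R : ℝ} (hR : ∀ z ∈ D, ‖z‖ ≤ R) {ε : ℝ}
    (hε : 0 ≤ ε) (x : Euc n) : copy D ε x ⊆ Metric.closedBall x (ε * R) := by
  rintro _ ⟨z, hz, rfl⟩
  simpa [norm_smul, abs_of_nonneg hε] using mul_le_mul_of_nonneg_left (hR z hz) hε

theorem copy_mul_add (D : Set (Euc n)) (ε t : ℝ) (x b : Euc n) :
    copy D (t * ε) (t • x + b) = (fun z => t • z + b) '' copy D ε x := by
  simp only [copy, image_image, smul_add, smul_smul, add_assoc]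

/-! ### Packings by translates of a scaled set -/

/-- The copies `εD + x`, with `x` in the finite set `X`, are pairwise disjoint. -/
def IsPacking (D : Set (Euc n)) (ε : ℝ) (X : Finset (Euc n)) : Prop :=
  (X : Set (Euc n)).PairwiseDisjoint (copy D ε)

/-- The largest value of `∑_{x ∈ X} f x` over all finite packings `X` at scale `ε`. -/
def packSum (D : Set (Euc n)) (ε : ℝ) (f : Euc n → ℝ≥0∞) : ℝ≥0∞ :=
  ⨆ (X : Finset (Euc n)) (_ : IsPacking D ε X), ∑ x ∈ X, f x

/-- The translational packing constant of `D`: the number of copies of `εD` that can be packed per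
volume `εⁿ`. It is encoded by duality, as the infimum of `packSum D 1 f` over the probability
densities `f` of bounded support, instead of as a limit of packing numbers of cubes. -/
def packConst (D : Set (Euc n)) : ℝ≥0∞ :=
  ⨅ (f : Euc n → ℝ≥0∞) (_ : Measurable f ∧ (∃ r : ℝ, ∀ x, r < ‖x‖ → f x = 0) ∧ ∫⁻ x, f x = 1),
    packSum D 1 f

theorem IsPacking.image_affine {D : Set (Euc n)} {ε : ℝ} {X : Finset (Euc n)}
    (hX : IsPacking D ε X) {t : ℝ} (ht : t ≠ 0) (b : Euc n) :
    IsPacking D (t * ε) (X.map ⟨fun x => t • x + b, (measurableEmbedding_dilate ht b).injective⟩)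
    := by
  intro x hx y hy hxy
  simp only [Finset.coe_map, Function.Embedding.coeFn_mk, mem_image, Finset.mem_coe] at hx hy
  obtain ⟨x, hx, rfl⟩ := hx
  obtain ⟨y, hy, rfl⟩ := hy
  simp only [Function.onFun, copy_mul_add]
  refine (disjoint_image_iff (measurableEmbedding_dilate ht b).injective).2 (hX hx hy ?_)
  rintro rfl
  exact hxy rfl

theorem IsPacking.sum_affine_le {D : Set (Euc n)} {ε : ℝ} {X : Finset (Euc n)}
    (hX : IsPacking D ε X) {t : ℝ} (ht : t ≠ 0) (b : Euc n) (f : Euc n → ℝ≥0∞) :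
    ∑ x ∈ X, f (t • x + b) ≤ packSum D (t * ε) f := by
  refine le_trans (le_of_eq ?_) (le_iSup₂_of_le _ (hX.image_affine ht b) le_rfl)
  rw [Finset.sum_map]
  rfl

/-- At every scale there is a packing that does at least as well as the packing constant predicts.
-/
theorem packConst_mul_lintegral_le (D : Set (Euc n)) {ε : ℝ} (hε : 0 < ε) {f : Euc n → ℝ≥0∞}
    (hf : Measurable f) (hs : ∃ r : ℝ, ∀ x, r < ‖x‖ → f x = 0) (hfin : ∫⁻ x, f x ≠ ∞) :
    packConst D * ∫⁻ x, f x ≤ ENNReal.ofReal (ε ^ n) * packSum D ε f := by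
  by_cases h0 : ∫⁻ x, f x = 0
  · simp [h0]
  have hε0 : ENNReal.ofReal (ε ^ n) ≠ 0 := by simpa using pow_pos hε n
  set M : ℝ≥0∞ := ∫⁻ x, f (ε • x) with hM
  have hMf : ENNReal.ofReal (ε ^ n) * M = ∫⁻ x, f x := by
    simpa using lintegral_dilate hε 0 f
  have hM0 : M ≠ 0 := by rintro h; rw [h, mul_zero] at hMf; exact h0 hMf.symm
  have hMt : M ≠ ∞ := by rintro h; rw [h, ENNReal.mul_top hε0] at hMf; exact hfin hMf.symm
  have key : packConst D ≤ M⁻¹ * packSum D ε f := by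
    unfold packConst
    refine iInf₂_le_of_le (fun x => M⁻¹ * f (ε • x)) ⟨by fun_prop, ?_, ?_⟩ ?_
    · obtain ⟨r, hr⟩ := hs
      refine ⟨ε⁻¹ * r, fun x hx => ?_⟩
      dsimp only
      rw [hr, mul_zero]
      rw [norm_smul, Real.norm_of_nonneg hε.le]
      rwa [inv_mul_lt_iff₀ hε] at hx
    · rw [lintegral_const_mul _ (by fun_prop), ENNReal.inv_mul_cancel hM0 hMt]
    · refine iSup₂_le fun X hX => ?_
      rw [← Finset.mul_sum]
      gcongr
      simpa using hX.sum_affine_le hε.ne' 0 f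
  calc packConst D * ∫⁻ x, f x = ENNReal.ofReal (ε ^ n) * (M * packConst D) := by
        rw [← hMf]; ring
    _ ≤ ENNReal.ofReal (ε ^ n) * (M * (M⁻¹ * packSum D ε f)) := by gcongr
    _ = _ := by rw [← mul_assoc M, ENNReal.mul_inv_cancel hM0 hMt, one_mul]

/-- Volume bound for the number of points of a packing in a ball. -/
theorem IsPacking.sum_indicator_le {D : Set (Euc n)} (hD : IsOpen D) {R : ℝ}
    (hR : ∀ z ∈ D, ‖z‖ ≤ R) {ε : ℝ} (hε : 0 < ε) {X : Finset (Euc n)} (hX : IsPacking D ε X)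
    (S : ℝ) :
    ENNReal.ofReal (ε ^ n) * (∑ x ∈ X, (Metric.closedBall (0 : Euc n) S).indicator 1 x) * volume D
      ≤ volume (Metric.closedBall (0 : Euc n) (S + ε * R)) := by
  classical
  have h1 : ∑ x ∈ X, (Metric.closedBall (0 : Euc n) S).indicator (1 : Euc n → ℝ≥0∞) x =
      ∑ x ∈ X with x ∈ Metric.closedBall (0 : Euc n) S, 1 := by
    rw [Finset.sum_filter]
    exact Finset.sum_congr rfl fun x _ => by simp [indicator_apply]
  rw [h1, mul_right_comm, Finset.mul_sum]
  simp only [mul_one]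
  have h2 : ∑ x ∈ X with x ∈ Metric.closedBall (0 : Euc n) S,
      ENNReal.ofReal (ε ^ n) * volume D =
      ∑ x ∈ X with x ∈ Metric.closedBall (0 : Euc n) S, volume (copy D ε x) :=
    Finset.sum_congr rfl fun x _ => (volume_copy hε x D).symm
  rw [h2, ← measure_biUnion_finset]
  · refine measure_mono (iUnion₂_subset fun x hx => (copy_subset_closedBall hR hε.le x).trans ?_)
    refine Metric.closedBall_subset_closedBall' ?_
    have := (Finset.mem_filter.1 hx).2
    rw [Metric.mem_closedBall] at this
    linarith
  · exact hX.subset fun x hx => (Finset.mem_filter.1 hx).1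
  · exact fun x _ => (isOpen_copy hD hε.ne' x).measurableSet

theorem packConst_ne_top {D : Set (Euc n)} (hD : IsOpen D) (hDb : Bornology.IsBounded D)
    (hne : D.Nonempty) : packConst D ≠ ∞ := by
  obtain ⟨R, hR⟩ := hDb.exists_norm_le
  set B := Metric.closedBall (0 : Euc n) 1
  have hB0 : volume B ≠ 0 := (Metric.measure_closedBall_pos _ _ one_pos).ne'
  have hBt : volume B ≠ ∞ := measure_closedBall_lt_top.ne
  have hD0 : volume D ≠ 0 := (hD.measure_pos _ hne).ne'
  have hDt : volume D ≠ ∞ := hDb.measure_lt_top.ne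
  have hint : ∫⁻ x, B.indicator (1 : Euc n → ℝ≥0∞) x = volume B :=
    lintegral_indicator_one Metric.isClosed_closedBall.measurableSet
  have h := packConst_mul_lintegral_le D one_pos (f := B.indicator (1 : Euc n → ℝ≥0∞))
    (measurable_one.indicator Metric.isClosed_closedBall.measurableSet)
    ⟨1, fun x hx => indicator_of_notMem (by simpa [B] using hx) _⟩ (by rwa [hint])
  have hp : packSum D 1 (B.indicator (1 : Euc n → ℝ≥0∞)) ≤
      volume (Metric.closedBall (0 : Euc n) (1 + 1 * R)) / volume D := by
    refine iSup₂_le fun X hX => ?_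
    rw [ENNReal.le_div_iff_mul_le (Or.inl hD0) (Or.inl hDt)]
    simpa using hX.sum_indicator_le hD hR one_pos 1
  intro ht
  rw [ht, hint, ENNReal.top_mul hB0] at h
  simp only [one_pow, ENNReal.ofReal_one, one_mul, top_le_iff] at h
  rw [h, top_le_iff] at hp
  exact ENNReal.div_ne_top measure_closedBall_lt_top.ne hD0 hp

/-- If `f` varies by at most `δ` at distance `εr` and `f₀` is a density supported in the ball of
radius `r`, then `f` may be replaced by its average with weight `f₀((x - ·)/ε)`; the sum over a
packing of these averages is an integral of sums of `f₀` over packings at scale `1`. -/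
theorem IsPacking.sum_le_of_density {D : Set (Euc n)} {ε : ℝ} (hε : 0 < ε) {X : Finset (Euc n)}
    (hX : IsPacking D ε X) {f f₀ : Euc n → ℝ≥0∞} (hf : Measurable f) (hf₀ : Measurable f₀)
    {r : ℝ} (hr : ∀ x, r < ‖x‖ → f₀ x = 0) (h1 : ∫⁻ x, f₀ x = 1) {h : Euc n → ℝ≥0∞}
    (hosc : ∀ x z, ‖x - z‖ ≤ ε * r → f x ≤ f z + h x) :
    ENNReal.ofReal (ε ^ n) * ∑ x ∈ X, f x ≤
      packSum D 1 f₀ * (∫⁻ x, f x) + ENNReal.ofReal (ε ^ n) * ∑ x ∈ X, h x := by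
  have hw : ∀ x : Euc n, ∫⁻ z, f₀ (ε⁻¹ • (x - z)) = ENNReal.ofReal (ε ^ n) := fun x => by
    have := lintegral_dilate hε 0 (fun y => f₀ (ε⁻¹ • y))
    rw [lintegral_sub_left_eq_self (fun y => f₀ (ε⁻¹ • y)), ← this]
    simp [smul_smul, hε.ne', h1]
  have hpt : ∀ x : Euc n, ENNReal.ofReal (ε ^ n) * f x ≤
      (∫⁻ z, f z * f₀ (ε⁻¹ • (x - z))) + ENNReal.ofReal (ε ^ n) * h x := fun x => by
    rw [← hw x, ← lintegral_mul_const _ (by fun_prop), ← lintegral_mul_const _ (by fun_prop),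
      ← lintegral_add_right _ (by fun_prop)]
    refine lintegral_mono fun z => ?_
    by_cases hz : ‖x - z‖ ≤ ε * r
    · calc f₀ (ε⁻¹ • (x - z)) * f x ≤ f₀ (ε⁻¹ • (x - z)) * (f z + h x) := by
            gcongr; exact hosc x z hz
        _ = _ := by ring
    · rw [hr (ε⁻¹ • (x - z))]
      · simp
      · rw [norm_smul, norm_inv, Real.norm_of_nonneg hε.le, lt_inv_mul_iff₀ hε]
        exact not_le.1 hz
  calc ENNReal.ofReal (ε ^ n) * ∑ x ∈ X, f x
      ≤ ∑ x ∈ X, ((∫⁻ z, f z * f₀ (ε⁻¹ • (x - z))) + ENNReal.ofReal (ε ^ n) * h x) := by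
        rw [Finset.mul_sum]
        exact Finset.sum_le_sum fun x _ => hpt x
    _ = (∫⁻ z, f z * ∑ x ∈ X, f₀ (ε⁻¹ • (x - z))) + ENNReal.ofReal (ε ^ n) * ∑ x ∈ X, h x := by
        rw [Finset.sum_add_distrib, Finset.mul_sum,
          ← lintegral_finsetSum _ (fun x _ => by fun_prop)]
        simp only [Finset.mul_sum]
    _ ≤ (∫⁻ z, f z * packSum D 1 f₀) + ENNReal.ofReal (ε ^ n) * ∑ x ∈ X, h x := by
        gcongr with z
        have := hX.sum_affine_le (inv_ne_zero hε.ne') (-(ε⁻¹ • z)) f₀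
        simpa only [inv_mul_cancel₀ hε.ne', ← sub_eq_add_neg, ← smul_sub] using this
    _ = _ := by rw [lintegral_mul_const _ hf, mul_comm]

/-- The packing constant is an upper bound in the limit. Together with `packConst_mul_lintegral_le`
this gives `εⁿ · packSum D ε f → packConst D · ∫ f` for continuous `f` with compact support. -/
theorem eventually_packSum_le {D : Set (Euc n)} (hD : IsOpen D) (hDb : Bornology.IsBounded D)
    (hne : D.Nonempty) {f : Euc n → ℝ≥0} (hf : Continuous f) (hfs : HasCompactSupport f)
    {c : ℝ≥0∞} (hc : packConst D * (∫⁻ x, f x) < c) :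
    ∀ᶠ ε in 𝓝[>] (0 : ℝ), ENNReal.ofReal (ε ^ n) * packSum D ε (fun x => f x) ≤ c := by
  obtain ⟨R, hR⟩ := hDb.exists_norm_le
  have hD0 : volume D ≠ 0 := (hD.measure_pos _ hne).ne'
  have hDt : volume D ≠ ∞ := hDb.measure_lt_top.ne
  have hfint : ∫⁻ x, (f x : ℝ≥0∞) ≠ ∞ := by
    have h : Integrable (fun x => (f x : ℝ)) (volume : Measure (Euc n)) :=
      (NNReal.continuous_coe.comp hf).integrable_of_hasCompactSupport
        (hfs.comp_left NNReal.coe_zero)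
    simpa [HasFiniteIntegral] using h.2.ne
  -- a density `f₀` that almost attains the infimum in `packConst`
  obtain ⟨f₀, ⟨hf₀, ⟨r, hr⟩, h1⟩, hlt⟩ : ∃ f₀ : Euc n → ℝ≥0∞, (Measurable f₀ ∧
      (∃ r : ℝ, ∀ x, r < ‖x‖ → f₀ x = 0) ∧ ∫⁻ x, f₀ x = 1) ∧
      packSum D 1 f₀ * (∫⁻ x, f x) < c := by
    by_cases hI : ∫⁻ x, (f x : ℝ≥0∞) = 0
    · have h := (packConst_ne_top hD hDb hne).lt_top
      simp only [packConst, iInf_lt_iff] at h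
      obtain ⟨f₀, hf₀, -⟩ := h
      exact ⟨f₀, hf₀, by rwa [hI, mul_zero] at hc ⊢⟩
    · rw [← ENNReal.lt_div_iff_mul_lt (Or.inl hI) (Or.inl hfint)] at hc
      simp only [packConst, iInf_lt_iff] at hc
      obtain ⟨f₀, hf₀, h⟩ := hc
      exact ⟨f₀, hf₀, (ENNReal.lt_div_iff_mul_lt (Or.inl hI) (Or.inl hfint)).1 h⟩
  obtain ⟨S, hS⟩ : ∃ S : ℝ, ∀ x, S < ‖x‖ → f x = 0 := by
    obtain ⟨S, hS⟩ := hfs.isBounded.exists_norm_le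
    refine ⟨S, fun x hx => ?_⟩
    by_contra h
    exact absurd (hS x (subset_tsupport _ h)) (not_le.2 hx)
  set V : ℝ≥0∞ := volume (Metric.closedBall (0 : Euc n) (S + |R|)) / volume D with hV
  have hVt : V ≠ ∞ := ENNReal.div_ne_top measure_closedBall_lt_top.ne hD0
  obtain ⟨δ, hδ0, hδ⟩ : ∃ δ : ℝ≥0, 0 < δ ∧ packSum D 1 f₀ * (∫⁻ x, f x) + δ * V ≤ c := by
    obtain ⟨δ, hδ0, hδ⟩ := ENNReal.exists_nnreal_pos_mul_lt hVt (tsub_pos_of_lt hlt).ne'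
    refine ⟨δ, hδ0, (add_le_add_right hδ.le _).trans ?_⟩
    rw [add_tsub_cancel_of_le hlt.le]
  have huc : UniformContinuous f := hfs.uniformContinuous_of_continuous hf
  obtain ⟨η, hη0, hη⟩ := Metric.uniformContinuous_iff.1 huc δ hδ0
  have hε1 : ∀ᶠ ε in 𝓝[>] (0 : ℝ), ε < 1 :=
    nhdsWithin_le_nhds (gt_mem_nhds one_pos)
  have hε2 : ∀ᶠ ε in 𝓝[>] (0 : ℝ), ε * r < η := by
    refine nhdsWithin_le_nhds ?_
    have : Tendsto (fun ε : ℝ => ε * r) (𝓝 0) (𝓝 (0 * r)) := tendsto_id.mul_const r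
    rw [zero_mul] at this
    exact this.eventually (gt_mem_nhds hη0)
  filter_upwards [hε1, hε2, self_mem_nhdsWithin] with ε hε1 hε2 (hε : 0 < ε)
  rw [packSum, ENNReal.mul_iSup]
  refine iSup_le fun X => ?_
  rw [ENNReal.mul_iSup]
  refine iSup_le fun hX => ?_
  refine le_trans (hX.sum_le_of_density hε (by fun_prop) hf₀ hr h1
    (h := fun x => δ * (Metric.closedBall (0 : Euc n) S).indicator 1 x) fun x z hxz => ?_) ?_
  · by_cases hx : S < ‖x‖
    · simp [hS x hx]
    · rw [indicator_of_mem (by simpa using hx)]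
      have := hη (dist_eq_norm x z ▸ hxz.trans_lt hε2)
      rw [NNReal.dist_eq] at this
      have h2 := (le_abs_self _).trans this.le
      rw [Pi.one_apply, mul_one, ← ENNReal.coe_add, ENNReal.coe_le_coe, ← NNReal.coe_le_coe]
      push_cast
      linarith
  · refine le_trans ?_ hδ
    refine add_le_add le_rfl ?_
    rw [← Finset.mul_sum, mul_left_comm]
    refine mul_le_mul_right ?_ _
    rw [hV, ENNReal.le_div_iff_mul_le (Or.inl hD0) (Or.inl hDt)]
    refine (hX.sum_indicator_le hD hR hε S).trans (measure_mono ?_)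
    refine Metric.closedBall_subset_closedBall ?_
    have : ε * R ≤ |R| := (le_abs_self _).trans (by
      rw [abs_mul, abs_of_pos hε]; exact mul_le_of_le_one_left (abs_nonneg _) hε1.le)
    linarith

/-! ### Distributional derivatives -/

theorem integrable_smul_of_locallyIntegrableOn {F : Type*} [NormedAddCommGroup F]
    [NormedSpace ℝ F] {Ω : Set (Euc n)} {g : Euc n → F} (hg : LocallyIntegrableOn g Ω)
    {φ : Euc n → ℝ} (hφ : Continuous φ) (hc : HasCompactSupport φ) (hs : tsupport φ ⊆ Ω) :
    Integrable (fun x => φ x • g x) := by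
  have h1 : IntegrableOn g (tsupport φ) := (hg.mono_set hs).integrableOn_isCompact hc
  refine (integrableOn_iff_integrable_of_support_subset ?_).1
    (h1.continuousOn_smul hφ.continuousOn hc)
  intro x hx
  refine subset_tsupport φ fun h => hx ?_
  simp [h]

theorem aestronglyMeasurable_smulRight {S : Set (Euc n)} (L : Mat m n →ₗ[ℝ] Mat m n)
    {u : Euc n → Euc m} (hu : AEStronglyMeasurable u (volume.restrict S))
    {ℓ : Euc n → Euc n →L[ℝ] ℝ} (hℓ : Continuous ℓ) :
    AEStronglyMeasurable (fun x => L ((ℓ x).smulRight (u x))) (volume.restrict S) := by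
  have h : Continuous fun q : (Euc n →L[ℝ] ℝ) × Euc m =>
      L.toContinuousLinearMap (q.1.smulRight q.2) :=
    L.toContinuousLinearMap.continuous.comp isBoundedBilinearMap_smulRight.continuous
  exact h.comp_aestronglyMeasurable (hℓ.aestronglyMeasurable.prodMk hu)

theorem integrable_apply_smulRight_fderiv {Ω : Set (Euc n)} (L : Mat m n →ₗ[ℝ] Mat m n)
    {u : Euc n → Euc m} (hu : LocallyIntegrableOn u Ω) {φ : Euc n → ℝ}
    (hφ : ContDiff ℝ (⊤ : ℕ∞) φ) (hc : HasCompactSupport φ) (hs : tsupport φ ⊆ Ω) :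
    Integrable (fun x => L ((fderiv ℝ φ x).smulRight (u x))) := by
  have hcont : Continuous (fderiv ℝ φ) := hφ.continuous_fderiv (by simp)
  have hcs : HasCompactSupport (fderiv ℝ φ) := hc.fderiv ℝ
  have hsub : tsupport (fderiv ℝ φ) ⊆ Ω := (tsupport_fderiv_subset ℝ).trans hs
  have hn : Integrable (fun x => ‖fderiv ℝ φ x‖ • ‖u x‖) := by
    refine integrable_smul_of_locallyIntegrableOn (Ω := Ω) hu.norm hcont.norm hcs.norm ?_
    refine (closure_mono ?_).trans hsub
    intro x hx h
    exact hx (by simp [h])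
  have h0 : Function.support (fun x => L ((fderiv ℝ φ x).smulRight (u x))) ⊆
      tsupport (fderiv ℝ φ) := by
    intro x hx
    refine subset_tsupport _ fun h => hx ?_
    simp [h]
  refine (integrableOn_iff_integrable_of_support_subset (ε' := Mat m n) h0).1 ?_
  refine Integrable.mono' (hn.const_mul ‖L.toContinuousLinearMap‖).integrableOn
    (aestronglyMeasurable_smulRight L
      ((hu.mono_set hsub).integrableOn_isCompact hcs).aestronglyMeasurable hcont)
    (Eventually.of_forall fun x => ?_)
  refine (L.toContinuousLinearMap.le_opNorm _).trans ?_
  rw [ContinuousLinearMap.norm_smulRight_apply, smul_eq_mul]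

/-- In the definition of `IsDistribD` one may integrate over the whole space, as the test function
is supported in `Ω`. -/
theorem integral_smul_eq_neg_iff {Ω : Set (Euc n)} (L : Mat m n →ₗ[ℝ] Mat m n)
    (u : Euc n → Euc m) (g : Euc n → Mat m n) {φ : Euc n → ℝ} (hs : tsupport φ ⊆ Ω) :
    (∫ x in Ω, φ x • g x = - ∫ x in Ω, L ((fderiv ℝ φ x).smulRight (u x))) ↔
      ∫ x, φ x • g x = - ∫ x, L ((fderiv ℝ φ x).smulRight (u x)) := by
  rw [setIntegral_eq_integral_of_forall_compl_eq_zero,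
    setIntegral_eq_integral_of_forall_compl_eq_zero]
  · intro x hx
    have : fderiv ℝ φ x = 0 := by
      by_contra h
      exact hx (hs (support_fderiv_subset ℝ h))
    simp [this]
  · intro x hx
    have : φ x = 0 := image_eq_zero_of_notMem_tsupport fun h => hx (hs h)
    rw [this]
    exact zero_smul ℝ (g x)

theorem IsDistribD.mono {L : Mat m n →ₗ[ℝ] Mat m n} {Ω V : Set (Euc n)} {u : Euc n → Euc m}
    {g : Euc n → Mat m n} (h : IsDistribD L Ω u g) (hV : V ⊆ Ω) : IsDistribD L V u g where
  locallyIntegrable_fun := h.1.mono_set hV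
  locallyIntegrable_deriv := h.2.mono_set hV
  integral_eq φ hφ hc hs := by
    rw [integral_smul_eq_neg_iff L u g hs, ← integral_smul_eq_neg_iff L u g (hs.trans hV)]
    exact h.3 φ hφ hc (hs.trans hV)

theorem IsDistribD.sub {L : Mat m n →ₗ[ℝ] Mat m n} {Ω : Set (Euc n)} {u v : Euc n → Euc m}
    {g h : Euc n → Mat m n} (hu : IsDistribD L Ω u g) (hv : IsDistribD L Ω v h) :
    IsDistribD L Ω (u - v) (g - h) where
  locallyIntegrable_fun := hu.1.sub hv.1
  locallyIntegrable_deriv := hu.2.sub hv.2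
  integral_eq φ hφ hc hs := by
    have e1 := (integral_smul_eq_neg_iff L u g hs).1 (hu.3 φ hφ hc hs)
    have e2 := (integral_smul_eq_neg_iff L v h hs).1 (hv.3 φ hφ hc hs)
    rw [integral_smul_eq_neg_iff L _ _ hs]
    have a1 : ∀ x, φ x • (g - h) x = φ x • g x - φ x • h x := fun x => smul_sub _ _ _
    have a2 : ∀ x, L ((fderiv ℝ φ x).smulRight ((u - v) x)) =
        L ((fderiv ℝ φ x).smulRight (u x)) - L ((fderiv ℝ φ x).smulRight (v x)) := fun x => by
      rw [← map_sub]
      congr 1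
      ext1 y
      simp [smul_sub]
    simp only [a1, a2]
    rw [integral_sub (integrable_smul_of_locallyIntegrableOn hu.2 hφ.continuous hc hs)
      (integrable_smul_of_locallyIntegrableOn hv.2 hφ.continuous hc hs),
      integral_sub (integrable_apply_smulRight_fderiv L hu.1 hφ hc hs)
      (integrable_apply_smulRight_fderiv L hv.1 hφ hc hs), e1, e2]
    abel

theorem IsDistribD.comp {L : Mat m n →ₗ[ℝ] Mat m n} {Ω : Set (Euc n)} (hΩ : IsOpen Ω)
    {u : Euc n → Euc m} {g : Euc n → Mat m n} (h : IsDistribD L Ω u g)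
    (M : Mat m n →ₗ[ℝ] Mat m n) : IsDistribD (M ∘ₗ L) Ω u (fun x => M (g x)) where
  locallyIntegrable_fun := h.1
  locallyIntegrable_deriv := by
    rw [locallyIntegrableOn_iff hΩ.isLocallyClosed]
    intro K hK hc
    exact M.toContinuousLinearMap.integrable_comp
      ((h.2.mono_set hK).integrableOn_isCompact hc)
  integral_eq φ hφ hc hs := by
    rw [integral_smul_eq_neg_iff _ _ _ hs]
    have e := (integral_smul_eq_neg_iff L u g hs).1 (h.3 φ hφ hc hs)
    have e1 := M.toContinuousLinearMap.integral_comp_comm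
      (integrable_smul_of_locallyIntegrableOn h.2 hφ.continuous hc hs)
    have e2 := M.toContinuousLinearMap.integral_comp_comm
      (integrable_apply_smulRight_fderiv L h.1 hφ hc hs)
    simp only [LinearMap.coe_toContinuousLinearMap', map_smul] at e1 e2
    simp only [LinearMap.comp_apply]
    rw [e1, e2, e, map_neg]

/-- The values of `D_L u` lie in the range of `L`. -/
theorem IsDistribD.ae_eq_zero {L : Mat m n →ₗ[ℝ] Mat m n} {Ω : Set (Euc n)} (hΩ : IsOpen Ω)
    {u : Euc n → Euc m} {g : Euc n → Mat m n} (h : IsDistribD L Ω u g)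
    {M : Mat m n →ₗ[ℝ] Mat m n} (hM : M ∘ₗ L = 0) :
    ∀ᵐ x ∂(volume.restrict Ω), M (g x) = 0 := by
  have h' := h.comp hΩ M
  rw [hM] at h'
  rw [ae_restrict_iff' hΩ.measurableSet]
  refine hΩ.ae_eq_zero_of_integral_contDiff_smul_eq_zero h'.2 fun φ hφ hc hs => ?_
  have e := (integral_smul_eq_neg_iff _ _ _ hs).1 (h'.3 φ hφ hc hs)
  simpa using e

/-- The distributional derivative of the linear map `B` is the constant `L B`. -/
theorem isDistribD_mat (L : Mat m n →ₗ[ℝ] Mat m n) (Ω : Set (Euc n)) (B : Mat m n) :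
    IsDistribD L Ω (fun x => B x) (fun _ => L B) where
  locallyIntegrable_fun := (B.continuous.locallyIntegrable).locallyIntegrableOn _
  locallyIntegrable_deriv := (locallyIntegrable_const _).locallyIntegrableOn _
  integral_eq φ hφ hc hs := by
    rw [integral_smul_eq_neg_iff L (fun x => B x) (fun _ => L B) hs]
    have hB := (B.continuous.locallyIntegrable (μ := volume)).locallyIntegrableOn univ
    have i1 : Integrable fun x => (fderiv ℝ φ x).smulRight (B x) :=
      integrable_apply_smulRight_fderiv LinearMap.id hB hφ hc (subset_univ _)
    have i2 : Integrable fun x => φ x • B := integrable_smul_of_locallyIntegrableOn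
      ((locallyIntegrable_const B).locallyIntegrableOn univ) hφ.continuous hc (subset_univ _)
    have key : ∫ x, φ x • B = - ∫ x, (fderiv ℝ φ x).smulRight (B x) := by
      ext1 e
      rw [neg_apply, ContinuousLinearMap.integral_apply i2,
        ContinuousLinearMap.integral_apply i1]
      have := integral_smul_fderiv_eq_neg_fderiv_smul_of_integrable (μ := volume) (f := φ)
        (g := B) (v := e) ?_ ?_ ?_ (fun x _ => (hφ.differentiable (by simp)).differentiableAt)
        (fun x _ => B.differentiableAt)
      · simpa using this
      · exact i1.apply_continuousLinearMap e
      · simpa using i2.apply_continuousLinearMap e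
      · exact integrable_smul_of_locallyIntegrableOn hB hφ.continuous hc (subset_univ _)
    have e1 := L.toContinuousLinearMap.integral_comp_comm i1
    have e2 := L.toContinuousLinearMap.integral_comp_comm i2
    simp only [LinearMap.coe_toContinuousLinearMap', map_smul] at e1 e2
    rw [e1, e2, key, map_neg]

theorem integral_dilate {F : Type*} [NormedAddCommGroup F] [NormedSpace ℝ F] {ε : ℝ}
    (hε : 0 < ε) (x : Euc n) (f : Euc n → F) :
    ∫ y, f (ε • y + x) = (ε ^ n)⁻¹ • ∫ y, f y := by
  rw [Measure.integral_comp_smul volume (fun z => f (z + x)), integral_add_right_eq_self,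
    finrank_euclideanSpace_fin, abs_of_pos (by positivity)]

theorem memLp_dilate {F : Type*} [NormedAddCommGroup F] {q : ℝ≥0∞} {D : Set (Euc n)} {ε : ℝ}
    (hε : 0 < ε) (x : Euc n) {f : Euc n → F} (hf : MemLp f q (volume.restrict (copy D ε x))) :
    MemLp (fun y => f (ε • y + x)) q (volume.restrict D) := by
  have he := measurableEmbedding_dilate hε.ne' x
  refine he.memLp_map_measure_iff.1 ?_
  rw [map_dilate_restrict hε]
  exact hf.smul_measure ENNReal.ofReal_ne_top

theorem LpLoc.dilate {p ε : ℝ} (hε : 0 < ε) (x : Euc n) {u : Euc n → Euc m}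
    (hu : LpLoc p univ u) : LpLoc p univ (fun y => u (ε • y + x)) := fun K hK _ =>
  memLp_dilate hε x (hu _ (hK.image (by fun_prop)) (subset_univ _))

theorem LpLoc.lpOn {F : Type*} [NormedAddCommGroup F] {p : ℝ} {u : Euc n → F}
    (hu : LpLoc p univ u) {D : Set (Euc n)} (hD : Bornology.IsBounded D) : LpOn p D u :=
  (hu _ hD.isCompact_closure (subset_univ _)).mono_measure
    (Measure.restrict_mono subset_closure le_rfl)

theorem LpLoc.sub {p : ℝ} {u v : Euc n → Euc m} (hu : LpLoc p univ u) (hv : LpLoc p univ v) :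
    LpLoc p univ (u - v) := fun K hK h => (hu K hK h).sub (hv K hK h)

theorem LpLoc.const_smul {p : ℝ} {u : Euc n → Euc m} (hu : LpLoc p univ u) (t : ℝ) :
    LpLoc p univ (t • u) := fun K hK h => (hu K hK h).const_smul t

theorem LpOn.locallyIntegrableOn {F : Type*} [NormedAddCommGroup F] {p : ℝ} (hp : 1 ≤ p)
    {Ω : Set (Euc n)} {f : Euc n → F} (hf : LpOn p Ω f) : LocallyIntegrableOn f Ω :=
  locallyIntegrableOn_of_locallyIntegrable_restrict
    (hf.locallyIntegrable (by simpa using ENNReal.ofReal_le_ofReal hp))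

/-- The chain rule for the distributional derivative and a map `y ↦ εy + x`. -/
theorem IsDistribD.isWLp_dilate {L : Mat m n →ₗ[ℝ] Mat m n} {p : ℝ} (hp : 1 ≤ p)
    {D : Set (Euc n)} (hDb : Bornology.IsBounded D) {ε : ℝ} (hε : 0 < ε) (x : Euc n)
    {u : Euc n → Euc m} (hu : LpLoc p univ u) {g : Euc n → Mat m n}
    (hg : LpOn p (copy D ε x) g) (h : IsDistribD L (copy D ε x) u g) :
    IsWLp L p D (fun y => u (ε • y + x)) (fun y => ε • g (ε • y + x)) := by
  have h1 : LpOn p D (fun y => u (ε • y + x)) := (hu.dilate hε x).lpOn hDb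
  have h2 : LpOn p D (fun y => ε • g (ε • y + x)) := (memLp_dilate hε x hg).const_smul ε
  refine ⟨h1, h2, h1.locallyIntegrableOn hp, h2.locallyIntegrableOn hp, fun φ hφ hc hs => ?_⟩
  rw [integral_smul_eq_neg_iff L _ _ hs]
  have hε1 : ∀ y : Euc n, ε⁻¹ • (ε • y + x - x) = y := fun y => by simp [smul_smul, hε.ne']
  let e : Euc n ≃ₜ Euc n := (Homeomorph.addRight (-x)).trans
    (Homeomorph.smulOfNeZero ε⁻¹ (inv_ne_zero hε.ne'))
  have he : ∀ z, e z = ε⁻¹ • (z - x) := fun z => by simp [e, sub_eq_add_neg]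
  set φ' : Euc n → ℝ := fun z => φ (ε⁻¹ • (z - x)) with hφ'
  have hφ'e : φ' = φ ∘ e := by ext z; simp [hφ', he]
  have hd : ContDiff ℝ (⊤ : ℕ∞) φ' := hφ.comp ((contDiff_id.sub contDiff_const).const_smul ε⁻¹)
  have hc' : HasCompactSupport φ' := by
    rw [hφ'e]; exact hc.comp_isClosedEmbedding e.isClosedEmbedding
  have hs' : tsupport φ' ⊆ copy D ε x := by
    intro z hz
    rw [hφ'e] at hz
    have := hs (tsupport_comp_subset_preimage φ e.continuous hz)
    refine ⟨e z, this, ?_⟩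
    simp [he, smul_smul, hε.ne']
  have key := (integral_smul_eq_neg_iff L u g hs').1 (h.3 φ' hd hc' hs')
  have hder : ∀ y, fderiv ℝ φ' (ε • y + x) = ε⁻¹ • fderiv ℝ φ y := fun y => by
    have hin : HasFDerivAt (fun z : Euc n => ε⁻¹ • (z - x))
        (ε⁻¹ • ContinuousLinearMap.id ℝ (Euc n)) (ε • y + x) :=
      ((hasFDerivAt_id _).sub_const x).const_smul ε⁻¹
    have hout : HasFDerivAt φ (fderiv ℝ φ y) (ε⁻¹ • (ε • y + x - x)) := by
      rw [hε1]
      exact (hφ.differentiable (by simp) y).hasFDerivAt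
    have hcomp : HasFDerivAt φ' _ (ε • y + x) :=
      HasFDerivAt.comp (f := fun z : Euc n => ε⁻¹ • (z - x)) (ε • y + x) hout hin
    rw [hcomp.fderiv]
    ext1 w
    simp
  have hval : ∀ y, φ' (ε • y + x) = φ y := fun y => by rw [hφ']; simp only [hε1]
  have e1 := integral_dilate hε x (fun z => φ' z • g z)
  have e2 := integral_dilate hε x (fun z => L ((fderiv ℝ φ' z).smulRight (u z)))
  simp only [hder, hval] at e1 e2
  have a1 : ∀ y, φ y • ε • g (ε • y + x) = ε • (φ y • g (ε • y + x)) := fun y =>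
    smul_comm _ _ _
  have a2 : ∀ y, L ((fderiv ℝ φ y).smulRight (u (ε • y + x))) =
      ε • L ((ε⁻¹ • fderiv ℝ φ y).smulRight (u (ε • y + x))) := fun y => by
    rw [← map_smul]
    congr 1
    ext1 w
    simp [smul_smul, hε.ne']
  simp only [a1, a2]
  rw [integral_smul, integral_smul, e1, e2, ← smul_neg, ← smul_neg]
  exact congrArg _ (congrArg _ key)

/-! ### Copies of the reference set and families of copies -/

theorem exists_aff_eq_dilate {ε : ℝ} (hε : ε ≠ 0) (x : Euc n) :
    ∃ F : Aff n, ∀ y, F y = ε • y + x :=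
  ⟨(LinearEquiv.smulOfNeZero ℝ (Euc n) ε hε).toAffineEquiv.trans
    (AffineEquiv.constVAdd ℝ (Euc n) x), fun y => by simp [add_comm]⟩

theorem mem_copies_gammaEps_iff {ε : ℝ} (hε : ε ≠ 0) {D' : Set (Euc n)} :
    D' ∈ copies (gammaEps ⊥ ε) D Ω ↔ (∃ x, D' = copy D ε x) ∧ D' ⊆ Ω := by
  refine and_congr_left fun _ => ⟨?_, ?_⟩
  · rintro ⟨F, ⟨R, hR, x, hF⟩, rfl⟩
    rw [Subgroup.mem_bot] at hR
    subst hR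
    exact ⟨x, image_congr fun y _ => hF y⟩
  · rintro ⟨x, rfl⟩
    obtain ⟨F, hF⟩ := exists_aff_eq_dilate hε x
    exact ⟨F, ⟨1, Subgroup.one_mem _, x, hF⟩, image_congr fun y _ => (hF y).symm⟩

/-- It suffices to bound the sums over finite packings, indexed by their centres. -/
theorem bmoG_le {ε : ℝ} (hε : 0 < ε) {u : Euc n → Euc m} {c : ℝ≥0∞}
    (h : ∀ X, IsPacking D ε X → (∀ x ∈ X, copy D ε x ⊆ Ω) →
      ENNReal.ofReal (ε ^ ((n : ℝ) - p)) * ∑ x ∈ X, (α u (copy D ε x) : ℝ≥0∞) ≤ c) :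
    bmoG p D ⊥ α ε u Ω ≤ c := by
  classical
  unfold bmoG
  rw [ENNReal.mul_iSup]
  refine iSup_le fun 𝒮 => ?_
  rw [ENNReal.mul_iSup]
  refine iSup_le fun h𝒮 => ?_
  rw [ENNReal.mul_iSup]
  refine iSup_le fun hd => ?_
  rw [ENNReal.tsum_eq_iSup_sum, ENNReal.mul_iSup]
  refine iSup_le fun T => ?_
  have hc : ∀ D' : 𝒮, ∃ x, (D' : Set (Euc n)) = copy D ε x := fun D' =>
    ((mem_copies_gammaEps_iff hε.ne').1 (h𝒮 D'.2)).1
  choose x hx using hc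
  have hinj : Function.Injective x := fun A B hAB => by
    rw [Subtype.ext_iff, hx A, hx B, hAB]
  have := h (T.map ⟨x, hinj⟩) ?_ ?_
  · rw [Finset.sum_map] at this
    simpa only [Function.Embedding.coeFn_mk, ← hx] using this
  · intro y hy z hz hyz
    simp only [Finset.coe_map, Function.Embedding.coeFn_mk, mem_image] at hy hz
    obtain ⟨A, -, rfl⟩ := hy
    obtain ⟨B, -, rfl⟩ := hz
    rw [Function.onFun, ← hx, ← hx]
    refine hd A.2 B.2 fun hAB => hyz ?_
    rw [Subtype.ext hAB]
  · intro y hy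
    simp only [Finset.mem_map, Function.Embedding.coeFn_mk] at hy
    obtain ⟨A, -, rfl⟩ := hy
    rw [← hx]
    exact (h𝒮 A.2).2

theorem IsPacking.le_bmoG (hne : D.Nonempty) {ε : ℝ} (hε : 0 < ε) {u : Euc n → Euc m}
    {X : Finset (Euc n)} (hX : IsPacking D ε X) (hΩ : ∀ x ∈ X, copy D ε x ⊆ Ω) :
    ENNReal.ofReal (ε ^ ((n : ℝ) - p)) * ∑ x ∈ X, (α u (copy D ε x) : ℝ≥0∞) ≤
      bmoG p D ⊥ α ε u Ω := by
  classical
  unfold bmoG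
  refine mul_le_mul_right ?_ _
  have hinj : InjOn (copy D ε) X := by
    intro x hx y hy hxy
    by_contra hne'
    have h := hX hx hy hne'
    rw [Function.onFun, hxy, disjoint_self] at h
    exact (hne.image _).ne_empty h
  refine le_iSup_of_le (X.image (copy D ε) : Finset (Set (Euc n))) (le_iSup₂_of_le ?_ ?_ ?_)
  · intro D' hD'
    simp only [Finset.coe_image, mem_image, Finset.mem_coe] at hD'
    obtain ⟨x, hx, rfl⟩ := hD'
    exact (mem_copies_gammaEps_iff hε.ne').2 ⟨⟨x, rfl⟩, hΩ x hx⟩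
  · rw [Finset.coe_image]
    exact (hinj.pairwiseDisjoint_image).2 hX
  · rw [Finset.tsum_subtype' (X.image (copy D ε)) (fun D' => (α u D' : ℝ≥0∞)),
      Finset.sum_image hinj]

theorem bmoG_mono {Ω' : Set (Euc n)} (h : Ω' ⊆ Ω) (ε : ℝ) (u : Euc n → Euc m) :
    bmoG p D ⊥ α ε u Ω' ≤ bmoG p D ⊥ α ε u Ω := by
  unfold bmoG
  gcongr with 𝒮
  refine iSup_le fun h𝒮 => le_iSup_of_le (fun D' hD' => ?_) le_rfl
  exact ⟨(h𝒮 hD').1, (h𝒮 hD').2.trans h⟩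

theorem IsPacking.sum_setLIntegral_le (hD : IsOpen D) {ε : ℝ} (hε : 0 < ε)
    {X : Finset (Euc n)} (hX : IsPacking D ε X) (hΩ : ∀ x ∈ X, copy D ε x ⊆ Ω)
    (f : Euc n → ℝ≥0∞) : ∑ x ∈ X, ∫⁻ z in copy D ε x, f z ≤ ∫⁻ z in Ω, f z := by
  rw [← lintegral_biUnion_finset hX fun x _ => (isOpen_copy hD hε.ne' x).measurableSet]
  exact lintegral_mono_set (iUnion₂_subset hΩ)

/-! ### Core functionals -/

theorem self_mem_copies {Γ : Subgroup (Aff n)} : D ∈ copies (Γ : Set (Aff n)) D univ :=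
  ⟨⟨1, Γ.one_mem, by simp [AffineEquiv.one_def]⟩, subset_univ _⟩

theorem IsPCore.apply_copy (hα : IsPCore p D (gammaGroup ⊥) α) {u : Euc n → Euc m}
    (hu : LpLoc p univ u) {ε : ℝ} (hε : 0 < ε) (x : Euc n) :
    α u (copy D ε x) = α (fun y => u (ε • y + x)) D := by
  obtain ⟨F, hF⟩ := exists_aff_eq_dilate hε.ne' x
  have h := hα.change_var D self_mem_copies u hu F ⟨ε, hε, 1, Subgroup.one_mem _, x, hF⟩
  have h1 : u ∘ F = fun y => u (ε • y + x) := by ext1 y; simp [hF]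
  have h2 : F '' D = copy D ε x := image_congr fun y _ => hF y
  rw [← h1, h, h2]

theorem IsPCore.apply_eq_zero_of_empty {Γ : Subgroup (Aff n)} (hα : IsPCore p ∅ Γ α)
    {u : Euc n → Euc m} (hu : LpLoc p univ u) : α u ∅ = 0 := by
  have hp : p ≠ 0 := (zero_lt_one.trans_le hα.one_le).ne'
  have h0 := hα.homogeneous ∅ self_mem_copies u hu 0
  rw [abs_zero, Real.zero_rpow hp, zero_mul] at h0
  rw [hα.ext_indep ∅ self_mem_copies u _ hu (hu.const_smul 0) (by simp [EventuallyEq])]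
  exact_mod_cast h0

/-- A convex functional that is positively homogeneous of degree `p` satisfies the triangle
inequality with a factor arbitrarily close to `1` on one of the summands. -/
theorem IsPCore.exists_le_add {Γ : Subgroup (Aff n)} (hα : IsPCore p D Γ α) {θ : ℝ≥0}
    (hθ : 1 < θ) : ∃ C : ℝ≥0, ∀ u v, LpLoc p univ u → LpLoc p univ v →
      α u D ≤ θ * α v D + C * α (u - v) D ∧ α v D ≤ θ * α u D + C * α (u - v) D := by
  obtain ⟨t, ht0, ht1, htθ⟩ : ∃ t : ℝ, 0 < t ∧ t < 1 ∧ t ^ (1 - p) < θ := by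
    have hc : Tendsto (fun t : ℝ => t ^ (1 - p)) (𝓝[<] 1) (𝓝 (1 ^ (1 - p))) :=
      ((Real.continuousAt_rpow_const 1 (1 - p) (Or.inl one_ne_zero)).tendsto).mono_left
        nhdsWithin_le_nhds
    rw [Real.one_rpow] at hc
    have h1 : ∀ᶠ t : ℝ in 𝓝[<] 1, 0 < t := nhdsWithin_le_nhds (lt_mem_nhds one_pos)
    obtain ⟨t, h⟩ := ((hc.eventually (gt_mem_nhds (by exact_mod_cast hθ))).and
      (h1.and self_mem_nhdsWithin)).exists
    exact ⟨t, h.2.1, h.2.2, h.1⟩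
  have hs0 : 0 < 1 - t := by linarith
  have hpow : ∀ s : ℝ, 0 < s → s * |s⁻¹| ^ p = s ^ (1 - p) := fun s hs => by
    rw [abs_of_pos (inv_pos.2 hs), Real.inv_rpow hs.le, ← div_eq_mul_inv, Real.rpow_sub hs,
      Real.rpow_one]
  have key : ∀ v w, LpLoc p univ v → LpLoc p univ w →
      (α (v + w) D : ℝ) ≤ θ * α v D + (1 - t) ^ (1 - p) * α w D := fun v w hv hw => by
    have hconv := hα.convex D self_mem_copies (t⁻¹ • v) ((1 - t)⁻¹ • w) (hv.const_smul _)
      (hw.const_smul _) t ht0.le ht1.le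
    rw [smul_smul, smul_smul, mul_inv_cancel₀ ht0.ne', mul_inv_cancel₀ hs0.ne', one_smul,
      one_smul, hα.homogeneous D self_mem_copies v hv, hα.homogeneous D self_mem_copies w hw,
      ← mul_assoc, ← mul_assoc, hpow t ht0, hpow _ hs0] at hconv
    refine hconv.trans ?_
    gcongr
  refine ⟨Real.toNNReal ((1 - t) ^ (1 - p)), fun u v hu hv => ?_⟩
  simp only [← NNReal.coe_le_coe, NNReal.coe_add, NNReal.coe_mul,
    Real.coe_toNNReal _ (Real.rpow_nonneg hs0.le (1 - p))]
  constructor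
  · simpa using key v (u - v) hv (hu.sub hv)
  · have h := key u ((-1 : ℝ) • (u - v)) hu ((hu.sub hv).const_smul _)
    rw [hα.homogeneous D self_mem_copies _ (hu.sub hv)] at h
    simpa using h

theorem IsPCore.smul_mat_ref {Γ : Subgroup (Aff n)} (hα : IsPCore p D Γ α) {ε : ℝ}
    (hε : 0 < ε) (A : Mat m n) :
    (α (fun x => (ε • A) x) D : ℝ≥0∞) = ENNReal.ofReal ε ^ p * α (fun x => A x) D := by
  have hp : 0 ≤ p := zero_le_one.trans hα.one_le
  rw [hα.smul_mat ε A self_mem_copies, ENNReal.coe_mul, ENNReal.coe_rpow_of_nonneg _ hp]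
  rw [ENNReal.ofReal, Real.nnabs_of_nonneg hε.le]

theorem IsPCore.continuous_mat {Γ : Subgroup (Aff n)} (hα : IsPCore p D Γ α) :
    Continuous fun A : Mat m n => α (fun x => A x) D := by
  have hc : ConvexOn ℝ univ fun A : Mat m n => (α (fun x => A x) D : ℝ) := by
    refine ⟨convex_univ, fun A _ B _ s t hs ht hst => ?_⟩
    obtain rfl : t = 1 - s := by linarith
    exact hα.convex D self_mem_copies _ _ (lpLoc_mat p A) (lpLoc_mat p B) s hs (by linarith)
  exact continuous_induced_rng.2 hc.locallyLipschitz.continuous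

theorem IsPCore.apply_zero_mat {Γ : Subgroup (Aff n)} (hα : IsPCore p D Γ α) :
    α (fun x => (0 : Mat m n) x) D = 0 := by
  have hp : p ≠ 0 := (zero_lt_one.trans_le hα.one_le).ne'
  have h := hα.smul_mat 0 (0 : Mat m n) self_mem_copies
  rw [map_zero, NNReal.zero_rpow hp, zero_mul] at h
  have hz : (0 : ℝ) • (0 : Mat m n) = 0 := by ext1 x; simp
  rwa [hz] at h

/-! ### Strong core functionals -/

theorem projection_comp_projection_of_isCompl {V : Type*} [AddCommGroup V] [Module ℝ V]
    {P Q N : Submodule ℝ V} (hP : IsCompl P N) (hQ : IsCompl Q N) :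
    Q.projection N hQ ∘ₗ P.projection N hP = Q.projection N hQ := by
  ext v
  have h : v - P.projection N hP v ∈ N := by
    rw [← Submodule.projection_eq_self_sub_projection]
    exact Submodule.projection_apply_mem _ _
  have h2 : Q.projection N hQ (v - P.projection N hP v) = 0 :=
    Submodule.projection_apply_of_mem_right hQ h
  rw [map_sub, sub_eq_zero] at h2
  exact h2.symm

theorem enorm_apply_rpow_le (hp : 0 ≤ p) (M : Mat m n →ₗ[ℝ] Mat m n) :
    ∃ c : ℝ≥0, ∀ A : Mat m n, ‖M A‖ₑ ^ p ≤ c * ‖A‖ₑ ^ p := by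
  refine ⟨‖M.toContinuousLinearMap‖₊ ^ p, fun A => ?_⟩
  rw [ENNReal.coe_rpow_of_nonneg _ hp, ← ENNReal.mul_rpow_of_nonneg _ _ hp]
  gcongr
  exact M.toContinuousLinearMap.le_opENorm A

/-- The bound that defines a strong core functional holds for every complement `P` of the null
space: if `P'` is another complement, then `D_{π_{P'}} u = π_{P'} (D_{π_P} u)`. -/
theorem IsStrongPCore.exists_bound (hα : IsStrongPCore p D ⊥ α) (hD : IsOpen D)
    (P : Submodule ℝ (Mat m n)) (hP : IsCompl P hα.isPCore.nullSpace) :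
    ∃ c : ℝ≥0, ∀ u g, LpLoc p univ u →
      IsWLp (P.projection hα.isPCore.nullSpace hP) p D u g →
      (α u D : ℝ≥0∞) ≤ c * ∫⁻ x in D, ‖g x‖ₑ ^ p := by
  have hp : 0 ≤ p := zero_le_one.trans hα.isPCore.one_le
  obtain ⟨Q, hQ, c, -, hc⟩ := hα.proj_bound
  obtain ⟨b, hb⟩ := enorm_apply_rpow_le hp (Q.projection _ hQ)
  refine ⟨c * b, fun u g hu hg => ?_⟩
  have h := hg.isDistribD.comp hD (Q.projection _ hQ)
  rw [projection_comp_projection_of_isCompl hP hQ] at h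
  refine (hc u _ hu ⟨hg.1, (Q.projection _ hQ).toContinuousLinearMap.comp_memLp' hg.2, h⟩).trans ?_
  rw [ENNReal.coe_mul, mul_assoc]
  refine mul_le_mul_right ?_ _
  rw [← lintegral_const_mul' _ _ ENNReal.coe_ne_top]
  exact lintegral_mono fun x => hb (g x)

/-- Comparison of `α` on a copy of `D` with its value on a linear map. -/
theorem IsPCore.compare_copy (hα : IsPCore p D (gammaGroup ⊥) α)
    {L : Mat m n →ₗ[ℝ] Mat m n} {c : ℝ≥0} (hc : ∀ u g, LpLoc p univ u → IsWLp L p D u g →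
      (α u D : ℝ≥0∞) ≤ c * ∫⁻ x in D, ‖g x‖ₑ ^ p) {θ C : ℝ≥0}
    (hC : ∀ u v, LpLoc p univ u → LpLoc p univ v →
      α u D ≤ θ * α v D + C * α (u - v) D ∧ α v D ≤ θ * α u D + C * α (u - v) D)
    {u : Euc n → Euc m} (hu : LpLoc p univ u) {g : Euc n → Mat m n} {ε : ℝ} (hε : 0 < ε)
    {x : Euc n} (hg : LpOn p (copy D ε x) g) (h : IsDistribD L (copy D ε x) u g) {A : Mat m n}
    (hA : L A = A) :
    ENNReal.ofReal (ε ^ ((n : ℝ) - p)) * α u (copy D ε x) ≤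
        θ * (ENNReal.ofReal (ε ^ n) * α (fun x => A x) D) +
          C * c * ∫⁻ z in copy D ε x, ‖g z - A‖ₑ ^ p ∧
      ENNReal.ofReal (ε ^ n) * α (fun x => A x) D ≤
        θ * (ENNReal.ofReal (ε ^ ((n : ℝ) - p)) * α u (copy D ε x)) +
          C * c * ∫⁻ z in copy D ε x, ‖g z - A‖ₑ ^ p := by
  have hp := hα.one_le
  have hp0 : 0 ≤ p := zero_le_one.trans hp
  have hDb := hα.isBounded_ref
  set v : Euc n → Euc m := fun y => u (ε • y + x) with hv
  set l : Euc n → Euc m := fun y => (ε • A) y with hl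
  set s := ENNReal.ofReal (ε ^ ((n : ℝ) - p)) with hs
  set r := ENNReal.ofReal ε ^ p with hr
  have hsr : s * r = ENNReal.ofReal (ε ^ n) := by
    rw [hs, hr, ENNReal.ofReal_rpow_of_pos hε, ← ENNReal.ofReal_mul (by positivity),
      ← Real.rpow_add hε, sub_add_cancel, Real.rpow_natCast]
  have hvL : LpLoc p univ v := hu.dilate hε x
  have hlL : LpLoc p univ l := lpLoc_mat p (ε • A)
  have h1 : IsWLp L p D v (fun y => ε • g (ε • y + x)) := h.isWLp_dilate hp hDb hε x hu hg
  have hfin : IsFiniteMeasure (volume.restrict D) := ⟨by simpa using hDb.measure_lt_top⟩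
  have h2 : IsWLp L p D (v - l) ((fun y => ε • g (ε • y + x)) - fun _ => L (ε • A)) :=
    ⟨h1.1.sub (hlL.lpOn hDb), h1.2.sub (memLp_const _), h1.3.sub (isDistribD_mat L D (ε • A))⟩
  have h3 : s * α (v - l) D ≤ c * ∫⁻ z in copy D ε x, ‖g z - A‖ₑ ^ p := by
    calc s * α (v - l) D
        ≤ s * (c * ∫⁻ y in D, r * ‖g (ε • y + x) - A‖ₑ ^ p) := by
          gcongr
          refine (hc _ _ (hvL.sub hlL) h2).trans (le_of_eq ?_)
          congr 2
          ext y
          have e : ε • g (ε • y + x) - ε • A = ε • (g (ε • y + x) - A) :=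
            (smul_sub ε _ _).symm
          rw [Pi.sub_apply, map_smul, hA, e, enorm_smul,
            ENNReal.mul_rpow_of_nonneg _ _ hp0, Real.enorm_of_nonneg hε.le]
      _ = c * ((s * r) * ∫⁻ y in D, ‖g (ε • y + x) - A‖ₑ ^ p) := by
          rw [lintegral_const_mul' _ _ (ENNReal.rpow_ne_top_of_nonneg hp0 ENNReal.ofReal_ne_top)]
          ring
      _ = _ := by
          rw [hsr, setLIntegral_dilate hε x D (fun z => ‖g z - A‖ₑ ^ p)]
  have h4 : s * (α l D : ℝ≥0∞) = ENNReal.ofReal (ε ^ n) * α (fun x => A x) D := by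
    rw [hl, hα.smul_mat_ref hε A, ← mul_assoc, hsr]
  rw [hα.apply_copy hu hε, ← h4]
  obtain ⟨k1, k2⟩ := hC v l hvL hlL
  constructor
  · calc s * (α v D : ℝ≥0∞) ≤ s * (θ * α l D + C * α (v - l) D) := by
          gcongr; exact_mod_cast k1
      _ = θ * (s * α l D) + C * (s * α (v - l) D) := by ring
      _ ≤ _ := by rw [mul_assoc (C : ℝ≥0∞)]; gcongr
  · calc s * (α l D : ℝ≥0∞) ≤ s * (θ * α v D + C * α (v - l) D) := by
          gcongr; exact_mod_cast k2
      _ = θ * (s * α v D) + C * (s * α (v - l) D) := by ring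
      _ ≤ _ := by rw [mul_assoc (C : ℝ≥0∞)]; gcongr

/-! ### Approximation by continuous functions -/

/-- Functions in `L^q(Ω)` are approximated by continuous functions with compact support in `Ω`. -/
theorem exists_tsupport_subset_eLpNorm_sub_le {F : Type*} [NormedAddCommGroup F]
    [NormedSpace ℝ F] (hΩ : IsOpen Ω) {q : ℝ≥0∞} (hq : q ≠ ∞) {f : Euc n → F}
    (hf : MemLp f q (volume.restrict Ω)) {ε : ℝ≥0∞} (hε : ε ≠ 0) :
    ∃ g : Euc n → F, eLpNorm (f - g) q (volume.restrict Ω) ≤ ε ∧ Continuous g ∧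
      MemLp g q (volume.restrict Ω) ∧ HasCompactSupport g ∧ tsupport g ⊆ Ω := by
  set ν := volume.restrict Ω with hν
  apply hf.induction_dense hq _ _ _ _ hε
  rotate_left
  · rintro f g ⟨f_cont, f_mem, hf, hf'⟩ ⟨g_cont, g_mem, hg, hg'⟩
    exact ⟨f_cont.add g_cont, f_mem.add g_mem, hf.add hg,
      (tsupport_add f g).trans (union_subset hf' hg')⟩
  · rintro f ⟨_, f_mem, _⟩
    exact f_mem.aestronglyMeasurable
  intro c t ht htν ε hε
  rcases exists_Lp_half F ν q hε with ⟨δ, δpos, hδ⟩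
  obtain ⟨η, ηpos, hη⟩ :
      ∃ η : ℝ≥0, 0 < η ∧ ∀ s, ν s ≤ η → eLpNorm (s.indicator fun _ => c) q ν ≤ δ :=
    exists_eLpNorm_indicator_le hq c δpos.ne'
  obtain ⟨s, st, s_compact, s_closed, νs⟩ :
      ∃ s, s ⊆ t ∩ Ω ∧ IsCompact s ∧ IsClosed s ∧ ν ((t ∩ Ω) \ s) < η :=
    (ht.inter hΩ.measurableSet).exists_isCompact_isClosed_sdiff_lt
      ((measure_mono inter_subset_left).trans_lt htν).ne (ENNReal.coe_pos.2 ηpos).ne'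
  have hst : s ⊆ t := st.trans inter_subset_left
  have hsν : ν s < ∞ := (measure_mono hst).trans_lt htν
  have νs' : ν (t \ s) ≤ η := by
    refine le_trans (le_of_eq ?_) νs.le
    rw [hν, Measure.restrict_apply (ht.diff s_closed.measurableSet),
      Measure.restrict_apply ((ht.inter hΩ.measurableSet).diff s_closed.measurableSet)]
    congr 1
    ext x
    simp only [mem_inter_iff, Set.mem_sdiff]
    tauto
  have I1 : eLpNorm ((s.indicator fun _ => c) - t.indicator fun _ => c) q ν ≤ δ := by
    rw [← eLpNorm_neg, neg_sub, ← indicator_sdiff hst]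
    exact hη _ νs'
  obtain ⟨k, k_compact, sk, kΩ⟩ := exists_compact_between s_compact hΩ
    (st.trans inter_subset_right)
  rcases exists_continuous_eLpNorm_sub_le_of_closed hq s_closed isOpen_interior sk hsν.ne c
    δpos.ne' with ⟨f, f_cont, I2, _, f_support, f_mem⟩
  have I3 : eLpNorm (f - t.indicator fun _ => c) q ν ≤ ε := by
    convert!
      (hδ _ _
          (f_mem.aestronglyMeasurable.sub
            (aestronglyMeasurable_const.indicator s_closed.measurableSet))
          ((aestronglyMeasurable_const.indicator s_closed.measurableSet).sub
            (aestronglyMeasurable_const.indicator ht))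
          I2 I1).le using 2
    simp only [sub_add_sub_cancel]
  have hfk : tsupport f ⊆ k :=
    closure_minimal (f_support.trans interior_subset) k_compact.isClosed
  exact ⟨f, I3, f_cont, f_mem, k_compact.of_isClosed_subset (isClosed_tsupport f) hfk,
    hfk.trans kΩ⟩

theorem exists_tsupport_subset_lintegral_le {F : Type*} [NormedAddCommGroup F]
    [NormedSpace ℝ F] (hΩ : IsOpen Ω) (hp : 0 < p) {f : Euc n → F} (hf : LpOn p Ω f) {η : ℝ≥0∞}
    (hη : η ≠ 0) :
    ∃ g : Euc n → F, Continuous g ∧ HasCompactSupport g ∧ tsupport g ⊆ Ω ∧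
      ∫⁻ x in Ω, ‖f x - g x‖ₑ ^ p ≤ η := by
  by_cases hηt : η = ∞
  · refine ⟨0, continuous_zero, HasCompactSupport.zero, ?_, by simp [hηt]⟩
    simp [tsupport]
  have hε : η ^ p⁻¹ ≠ 0 := by simp [ENNReal.rpow_eq_zero_iff, hη, hηt]
  obtain ⟨g, hg, hc, -, hs, ht⟩ :=
    exists_tsupport_subset_eLpNorm_sub_le hΩ ENNReal.ofReal_ne_top hf hε
  refine ⟨g, hc, hs, ht, ?_⟩
  rw [eLpNorm_eq_lintegral_rpow_enorm_toReal (by simpa using hp) ENNReal.ofReal_ne_top,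
    ENNReal.toReal_ofReal hp.le, one_div, ENNReal.rpow_le_rpow_iff (inv_pos.2 hp)] at hg
  exact hg

/-- An approximation that takes values in the range of a projection `π`. -/
theorem exists_approx_of_projection (hΩ : IsOpen Ω) (hp : 0 < p)
    {π : Mat m n →ₗ[ℝ] Mat m n} (hπ : ∀ A, π (π A) = π A) {g : Euc n → Mat m n}
    (hg : LpOn p Ω g) (hgπ : ∀ᵐ x ∂(volume.restrict Ω), π (g x) = g x) {η : ℝ≥0∞}
    (hη : η ≠ 0) :
    ∃ h : Euc n → Mat m n, Continuous h ∧ HasCompactSupport h ∧ tsupport h ⊆ Ω ∧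
      (∀ x, π (h x) = h x) ∧ ∫⁻ x in Ω, ‖g x - h x‖ₑ ^ p ≤ η := by
  obtain ⟨b, hb⟩ := enorm_apply_rpow_le hp.le π
  obtain ⟨h, hc, hs, ht, hle⟩ := exists_tsupport_subset_lintegral_le hΩ hp hg
    (η := η / b) (by simp [hη])
  refine ⟨fun x => π (h x), π.toContinuousLinearMap.continuous.comp hc,
    hs.comp_left (map_zero π), (closure_mono ?_).trans ht, fun x => hπ _, ?_⟩
  · intro x hx hx'
    exact hx (by simp [hx'])
  · calc ∫⁻ x in Ω, ‖g x - π (h x)‖ₑ ^ p ≤ ∫⁻ x in Ω, b * ‖g x - h x‖ₑ ^ p := by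
          refine lintegral_mono_ae ?_
          filter_upwards [hgπ] with x hx
          have := hb (g x - h x)
          rwa [map_sub, hx] at this
      _ = b * ∫⁻ x in Ω, ‖g x - h x‖ₑ ^ p := lintegral_const_mul' _ _ ENNReal.coe_ne_top
      _ ≤ b * (η / b) := by gcongr
      _ ≤ η := ENNReal.mul_div_le

/-- In a fine packing, replacing `h` on each copy by its value at the centre costs little in
`L^p`, because `h` is uniformly continuous and only copies in a fixed ball contribute. -/
theorem eventually_sum_oscillation_le {F : Type*} [NormedAddCommGroup F] (hD : IsOpen D)
    (hDb : Bornology.IsBounded D) (hp : 0 < p) {h : Euc n → F} (hc : Continuous h)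
    (hs : HasCompactSupport h) {η : ℝ≥0∞} (hη : η ≠ 0) :
    ∀ᶠ ε in 𝓝[>] (0 : ℝ), ∀ X, IsPacking D ε X →
      ∑ x ∈ X, ∫⁻ z in copy D ε x, ‖h z - h x‖ₑ ^ p ≤ η := by
  obtain ⟨R, hR⟩ := hDb.exists_norm_le
  obtain ⟨S, hS⟩ : ∃ S : ℝ, ∀ x, S < ‖x‖ → h x = 0 := by
    obtain ⟨S, hS⟩ := hs.isBounded.exists_norm_le
    refine ⟨S, fun x hx => ?_⟩
    by_contra h'
    exact absurd (hS x (subset_tsupport _ h')) (not_le.2 hx)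
  set B := Metric.closedBall (0 : Euc n) (S + |R|) with hB
  have hBt : volume B ≠ ∞ := measure_closedBall_lt_top.ne
  obtain ⟨δ, hδ0, hδ⟩ := ENNReal.exists_nnreal_pos_mul_lt hBt hη
  have hδp : 0 < δ ^ p⁻¹ := NNReal.rpow_pos hδ0
  obtain ⟨t, ht0, ht⟩ := Metric.uniformContinuous_iff.1
    (hs.uniformContinuous_of_continuous hc) (δ ^ p⁻¹ : ℝ≥0) (by exact_mod_cast hδp)
  have hε1 : ∀ᶠ ε in 𝓝[>] (0 : ℝ), ε < 1 := nhdsWithin_le_nhds (gt_mem_nhds one_pos)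
  have hε2 : ∀ᶠ ε in 𝓝[>] (0 : ℝ), ε * R < t := by
    refine nhdsWithin_le_nhds ?_
    have : Tendsto (fun ε : ℝ => ε * R) (𝓝 0) (𝓝 (0 * R)) := tendsto_id.mul_const R
    rw [zero_mul] at this
    exact this.eventually (gt_mem_nhds ht0)
  filter_upwards [hε1, hε2, self_mem_nhdsWithin] with ε hε1 hε2 (hε : 0 < ε) X hX
  have hpt : ∀ x, ∀ z ∈ copy D ε x,
      ‖h z - h x‖ₑ ^ p ≤ B.indicator (fun _ => (δ : ℝ≥0∞)) z := by
    intro x z hz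
    have hzx : dist z x ≤ ε * R := by simpa using copy_subset_closedBall hR hε.le x hz
    by_cases hzB : z ∈ B
    · rw [indicator_of_mem hzB]
      have h1 := (ht (hzx.trans_lt hε2)).le
      rw [dist_eq_norm] at h1
      have h2 : ‖h z - h x‖ₑ ≤ ((δ ^ p⁻¹ : ℝ≥0) : ℝ≥0∞) := by
        rw [enorm_le_coe]; exact_mod_cast h1
      refine (ENNReal.rpow_le_rpow h2 hp.le).trans (le_of_eq ?_)
      rw [← ENNReal.coe_rpow_of_nonneg _ hp.le, ← NNReal.rpow_mul, inv_mul_cancel₀ hp.ne',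
        NNReal.rpow_one]
    · have hz' : S + |R| < ‖z‖ := by simpa [hB] using hzB
      have hRle : ε * R ≤ |R| := (le_abs_self _).trans (by
        rw [abs_mul, abs_of_pos hε]; exact mul_le_of_le_one_left (abs_nonneg _) hε1.le)
      have hx' : S < ‖x‖ := by
        have := norm_le_norm_add_norm_sub' z x
        rw [← dist_eq_norm] at this
        linarith
      rw [hS z (by linarith [abs_nonneg R]), hS x hx']
      simp [hp]
  calc ∑ x ∈ X, ∫⁻ z in copy D ε x, ‖h z - h x‖ₑ ^ p
      ≤ ∑ x ∈ X, ∫⁻ z in copy D ε x, B.indicator (fun _ => (δ : ℝ≥0∞)) z :=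
        Finset.sum_le_sum fun x _ => setLIntegral_mono' (isOpen_copy hD hε.ne' x).measurableSet
          (hpt x)
    _ ≤ ∫⁻ z in univ, B.indicator (fun _ => (δ : ℝ≥0∞)) z :=
        hX.sum_setLIntegral_le hD hε (fun x _ => subset_univ _) _
    _ = δ * volume B := by
        rw [Measure.restrict_univ,
          lintegral_indicator_const Metric.isClosed_closedBall.measurableSet]
    _ ≤ η := hδ.le

/-- A criterion for convergence in `[0, ∞]` by two-sided bounds with factors arbitrarily close to
`1` and arbitrarily small errors. -/
theorem tendsto_of_forall_eventually_le {ι : Type*} {l : Filter ι} {G : ι → ℝ≥0∞} {I : ℝ≥0∞}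
    (hI : I ≠ ∞) (h : ∀ θ : ℝ≥0, 1 < θ → ∀ e : ℝ≥0∞, e ≠ 0 →
      ∀ᶠ i in l, G i ≤ θ * (θ * I) + e ∧ I ≤ θ * (θ * G i) + e) : Tendsto G l (𝓝 I) := by
  have key : ∀ a b : ℝ≥0∞, a < b → a ≠ ∞ →
      ∃ θ : ℝ≥0, 1 < θ ∧ ∃ e : ℝ≥0∞, e ≠ 0 ∧ θ * (θ * a) + e < b := by
    intro a b hab ha
    have hc : Tendsto (fun t : ℝ≥0 => (t : ℝ≥0∞) * (t * a)) (𝓝[>] 1) (𝓝 a) := by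
      have h1 : Tendsto (fun t : ℝ≥0 => (t : ℝ≥0∞)) (𝓝[>] 1) (𝓝 ((1 : ℝ≥0) : ℝ≥0∞)) :=
        (ENNReal.continuous_coe.tendsto 1).mono_left nhdsWithin_le_nhds
      have h2 := ENNReal.Tendsto.mul h1 (Or.inl (by simp))
        (ENNReal.Tendsto.mul_const (b := a) h1 (Or.inr ha)) (Or.inr (by simp))
      simpa using h2
    have hne : (𝓝[>] (1 : ℝ≥0)).NeBot := inferInstance
    obtain ⟨t, ht, ht1⟩ := ((hc.eventually (gt_mem_nhds hab)).and self_mem_nhdsWithin).exists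
    obtain ⟨e, he0, he⟩ := exists_between (tsub_pos_of_lt ht)
    exact ⟨t, ht1, e, he0.ne', lt_tsub_iff_left.1 he⟩
  refine tendsto_order.2 ⟨fun b hb => ?_, fun b hb => ?_⟩
  · obtain ⟨θ, hθ, e, he, hlt⟩ := key b I hb (hb.trans_le le_top).ne
    filter_upwards [h θ hθ e he] with i hi
    by_contra hcon
    refine absurd (hi.2.trans ?_) (not_le.2 hlt)
    gcongr
    exact not_lt.1 hcon
  · obtain ⟨θ, hθ, e, he, hlt⟩ := key I b hb hI
    filter_upwards [h θ hθ e he] with i hi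
    exact hi.1.trans_lt hlt

/-! ### The limit of the seminorms -/

theorem projection_projection {V : Type*} [AddCommGroup V] [Module ℝ V] {P N : Submodule ℝ V}
    (hP : IsCompl P N) (v : V) : P.projection N hP (P.projection N hP v) = P.projection N hP v :=
  Submodule.projection_apply_of_mem_left hP (Submodule.projection_apply_mem hP v)

theorem IsDistribD.ae_projection_eq (hΩ : IsOpen Ω) {P N : Submodule ℝ (Mat m n)}
    {hP : IsCompl P N} {u : Euc n → Euc m} {g : Euc n → Mat m n}
    (h : IsDistribD (P.projection N hP) Ω u g) :
    ∀ᵐ x ∂(volume.restrict Ω), P.projection N hP (g x) = g x := by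
  have hM : (LinearMap.id - P.projection N hP) ∘ₗ P.projection N hP = 0 := by
    ext1 A
    simp only [LinearMap.comp_apply, LinearMap.sub_apply, LinearMap.id_apply,
      projection_projection, sub_self, LinearMap.zero_apply]
  filter_upwards [h.ae_eq_zero hΩ hM] with x hx
  rw [LinearMap.sub_apply, LinearMap.id_apply, sub_eq_zero] at hx
  exact hx.symm

theorem IsPCore.le_enorm_rpow (hα : IsPCore p D (gammaGroup ⊥) α)
    {L : Mat m n →ₗ[ℝ] Mat m n} {c : ℝ≥0} (hc : ∀ u g, LpLoc p univ u → IsWLp L p D u g →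
      (α u D : ℝ≥0∞) ≤ c * ∫⁻ x in D, ‖g x‖ₑ ^ p) {A : Mat m n} :
    (α (fun x => A x) D : ℝ≥0∞) ≤ c * volume D * ‖L A‖ₑ ^ p := by
  have hDb := hα.isBounded_ref
  have hfin : IsFiniteMeasure (volume.restrict D) := ⟨by simpa using hDb.measure_lt_top⟩
  have h := hc _ _ (lpLoc_mat p A)
    ⟨(lpLoc_mat p A).lpOn hDb, memLp_const _, isDistribD_mat L D A⟩
  rw [setLIntegral_const] at h
  exact h.trans (le_of_eq (by ring))

/-- On linear maps `α` is comparable for two matrix fields that are close in `L^p`. -/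
theorem IsPCore.lintegral_mat_le (hα : IsPCore p D (gammaGroup ⊥) α)
    {L : Mat m n →ₗ[ℝ] Mat m n} {c : ℝ≥0} (hc : ∀ u g, LpLoc p univ u → IsWLp L p D u g →
      (α u D : ℝ≥0∞) ≤ c * ∫⁻ x in D, ‖g x‖ₑ ^ p) {θ C : ℝ≥0}
    (hC : ∀ u v, LpLoc p univ u → LpLoc p univ v → α u D ≤ θ * α v D + C * α (u - v) D)
    {μ : Measure (Euc n)} {g h : Euc n → Mat m n} (hg : AEStronglyMeasurable g μ)
    (hgL : ∀ᵐ x ∂μ, L (g x) = g x) (hhL : ∀ᵐ x ∂μ, L (h x) = h x) :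
    ∫⁻ x, (α (fun y => h x y) D : ℝ≥0∞) ∂μ ≤ θ * ∫⁻ x, (α (fun y => g x y) D : ℝ≥0∞) ∂μ +
      C * c * volume D * ∫⁻ x, ‖g x - h x‖ₑ ^ p ∂μ := by
  have hK : (C : ℝ≥0∞) * c * volume D ≠ ∞ :=
    ENNReal.mul_ne_top (by finiteness) hα.isBounded_ref.measure_lt_top.ne
  have hmeas : AEMeasurable (fun x => (θ : ℝ≥0∞) * α (fun y => g x y) D) μ :=
    ((hα.continuous_mat.comp_aestronglyMeasurable hg).aemeasurable.coe_nnreal_ennreal).const_mul _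
  rw [← lintegral_const_mul' _ _ ENNReal.coe_ne_top, ← lintegral_const_mul' _ _ hK,
    ← lintegral_add_left' hmeas]
  refine lintegral_mono_ae ?_
  filter_upwards [hgL, hhL] with x hx hx'
  have h1 := hC _ _ (lpLoc_mat p (h x)) (lpLoc_mat p (g x))
  have h2 := hα.le_enorm_rpow hc (A := h x - g x)
  have h3 : ‖L (h x - g x)‖ₑ = ‖g x - h x‖ₑ := by rw [map_sub, hx, hx', enorm_sub_rev]
  rw [h3] at h2
  calc (α (fun y => h x y) D : ℝ≥0∞)
      ≤ θ * α (fun y => g x y) D + C * α (fun y => (h x - g x) y) D := by exact_mod_cast h1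
    _ ≤ θ * α (fun y => g x y) D + C * (c * volume D * ‖g x - h x‖ₑ ^ p) := by gcongr
    _ = _ := by ring

/-- The limit for `D_π u ∈ L^p(Ω)`: with `f ∈ C_c(Ω)` close to `g` in `L^p(Ω)`, the value of `α` on
a copy `εD + x` is compared with its value on the linear map `f x`, up to a factor `θ` and errors
that sum up to a multiple of `‖g - f‖_p^p`; the sums of the values on linear maps are packing sums
of `a ∘ f`, where `a A = α(l^A, D)`. -/
theorem IsStrongPCore.tendsto_bmoG_of_nonempty (hα : IsStrongPCore p D ⊥ α) (hne : D.Nonempty)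
    (hΩ : IsOpen Ω) (P : Submodule ℝ (Mat m n)) (hP : IsCompl P hα.isPCore.nullSpace)
    {u : Euc n → Euc m} (hu : LpLoc p univ u) {g : Euc n → Mat m n}
    (h : IsDistribD (P.projection hα.isPCore.nullSpace hP) Ω u g) (hg : LpOn p Ω g) :
    Tendsto (fun ε : ℝ => bmoG p D ⊥ α ε u Ω) (𝓝[>] 0)
      (𝓝 (packConst D * ∫⁻ x in Ω, (α (fun y => g x y) D : ℝ≥0∞))) := by
  classical
  have hcore := hα.isPCore
  have hp0 : 0 < p := zero_lt_one.trans_le hcore.one_le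
  have hD := hcore.isOpen_ref
  have hDb := hcore.isBounded_ref
  obtain ⟨c, hc⟩ := hα.exists_bound hD P hP
  set π := P.projection hα.isPCore.nullSpace hP with hπdef
  have hgπ : ∀ᵐ x ∂(volume.restrict Ω), π (g x) = g x := h.ae_projection_eq hΩ
  set κ := packConst D with hκ
  have hκt : κ ≠ ∞ := packConst_ne_top hD hDb hne
  have hDt : volume D ≠ ∞ := hDb.measure_lt_top.ne
  set a : Mat m n → ℝ≥0 := fun A => α (fun y => A y) D with ha
  have hac : Continuous a := hcore.continuous_mat
  -- finiteness of the limit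
  have hfin : ∫⁻ x in Ω, (a (g x) : ℝ≥0∞) ≠ ∞ := by
    have hgp : ∫⁻ x in Ω, ‖g x‖ₑ ^ p ≠ ∞ := by
      have := lintegral_rpow_enorm_lt_top_of_eLpNorm_lt_top (by simpa using hp0)
        ENNReal.ofReal_ne_top hg.2
      rw [ENNReal.toReal_ofReal hp0.le] at this
      exact this.ne
    have hK : (c : ℝ≥0∞) * volume D ≠ ∞ := ENNReal.mul_ne_top (by finiteness) hDt
    refine ne_top_of_le_ne_top (ENNReal.mul_ne_top hK hgp) ?_
    rw [← lintegral_const_mul' _ _ hK]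
    refine lintegral_mono_ae ?_
    filter_upwards [hgπ] with x hx
    have := hcore.le_enorm_rpow hc (A := g x)
    rwa [hx] at this
  refine tendsto_of_forall_eventually_le (ENNReal.mul_ne_top hκt hfin) fun θ hθ e he => ?_
  obtain ⟨C, hC⟩ := hcore.exists_le_add hθ
  -- the total error is at most `K η`
  set T : ℝ≥0∞ := C * c * (2 ^ (p - 1) * 2) with hT
  set V : ℝ≥0∞ := C * c * volume D with hV
  have hTt : T ≠ ∞ := by
    refine ENNReal.mul_ne_top (by finiteness) (ENNReal.mul_ne_top ?_ (by finiteness))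
    exact ENNReal.rpow_ne_top_of_nonneg (by linarith [hcore.one_le]) (by finiteness)
  have hVt : V ≠ ∞ := ENNReal.mul_ne_top (by finiteness) hDt
  set K : ℝ≥0∞ := θ * κ * V + θ + κ * V + T + θ * T with hK
  have hKt : K ≠ ∞ := by rw [hK]; finiteness
  obtain ⟨η, hη0, hη⟩ := ENNReal.exists_nnreal_pos_mul_lt hKt he
  have hη0' : (η : ℝ≥0∞) ≠ 0 := by exact_mod_cast hη0.ne'
  obtain ⟨f, hfc, hfs, hfΩ, hfπ, hfg⟩ := exists_approx_of_projection hΩ hp0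
    (projection_projection hP) hg hgπ hη0'
  have hac' : Continuous fun x => a (f x) := hac.comp hfc
  have ha0 : a 0 = 0 := hcore.apply_zero_mat
  have has : HasCompactSupport fun x => a (f x) := hfs.comp_left ha0
  have haΩ : ∫⁻ x in Ω, (a (f x) : ℝ≥0∞) = ∫⁻ x, (a (f x) : ℝ≥0∞) := by
    refine setLIntegral_eq_of_support_subset ?_
    intro x hx
    refine hfΩ (subset_tsupport f fun h0 => hx ?_)
    simp [h0, ha0]
  -- `κ ∫ a(f)` is close to `κ ∫ a(g)`
  set If := ∫⁻ x, (a (f x) : ℝ≥0∞)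
  set Ig := ∫⁻ x in Ω, (a (g x) : ℝ≥0∞)
  have hfa1 : If ≤ θ * Ig + V * η := by
    rw [← haΩ]
    refine (hcore.lintegral_mat_le hc (fun u v hu hv => (hC u v hu hv).1) hg.1 hgπ
      (Eventually.of_forall hfπ)).trans ?_
    gcongr
  have hfa2 : Ig ≤ θ * If + V * η := by
    rw [← haΩ]
    refine (hcore.lintegral_mat_le hc (fun u v hu hv => (hC u v hu hv).1)
      hfc.aestronglyMeasurable (Eventually.of_forall hfπ) hgπ).trans ?_
    simp only [enorm_sub_rev (f _)]
    gcongr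
  have haft : If ≠ ∞ := ne_top_of_le_ne_top (by finiteness) hfa1
  -- copies of `D` with centre in the support of `f` lie in `Ω`
  obtain ⟨R, hR⟩ := hDb.exists_norm_le
  obtain ⟨ρ, hρ0, hρ⟩ := hfs.isCompact.exists_cthickening_subset_open hΩ hfΩ
  have hερ : ∀ᶠ ε in 𝓝[>] (0 : ℝ), ε * R < ρ := by
    refine nhdsWithin_le_nhds ?_
    have : Tendsto (fun ε : ℝ => ε * R) (𝓝 0) (𝓝 (0 * R)) := tendsto_id.mul_const R
    rw [zero_mul] at this
    exact this.eventually (gt_mem_nhds hρ0)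
  have hpack := eventually_packSum_le hD hDb hne hac' has (c := κ * If + η)
    (ENNReal.lt_add_right (by finiteness) hη0')
  filter_upwards [hερ, hpack, eventually_sum_oscillation_le hD hDb hp0 hfc hfs hη0',
    self_mem_nhdsWithin] with ε hερ hpack hosc (hε : 0 < ε)
  have herr : ∀ X, IsPacking D ε X → (∀ x ∈ X, copy D ε x ⊆ Ω) →
      C * c * ∑ x ∈ X, ∫⁻ z in copy D ε x, ‖g z - f x‖ₑ ^ p ≤ T * η := by
    intro X hX hXΩ
    rw [hT, mul_assoc (C * c : ℝ≥0∞)]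
    gcongr
    calc ∑ x ∈ X, ∫⁻ z in copy D ε x, ‖g z - f x‖ₑ ^ p
        ≤ ∑ x ∈ X, 2 ^ (p - 1) * ((∫⁻ z in copy D ε x, ‖g z - f z‖ₑ ^ p) +
            ∫⁻ z in copy D ε x, ‖f z - f x‖ₑ ^ p) := by
          refine Finset.sum_le_sum fun x _ => ?_
          have hmeas : Measurable fun z => ‖f z - f x‖ₑ ^ p :=
            ((hfc.sub continuous_const).enorm.measurable).pow_const p
          rw [← lintegral_add_right _ hmeas, ← lintegral_const_mul' _ _
            (ENNReal.rpow_ne_top_of_nonneg (by linarith [hcore.one_le]) (by finiteness))]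
          refine lintegral_mono fun z => ?_
          have h1 : ‖g z - f x‖ₑ ≤ ‖g z - f z‖ₑ + ‖f z - f x‖ₑ := by
            have := enorm_add_le (g z - f z) (f z - f x)
            rwa [sub_add_sub_cancel] at this
          exact (ENNReal.rpow_le_rpow h1 hp0.le).trans
            (ENNReal.rpow_add_le_mul_rpow_add_rpow _ _ hcore.one_le)
      _ = 2 ^ (p - 1) * (∑ x ∈ X, (∫⁻ z in copy D ε x, ‖g z - f z‖ₑ ^ p) +
            ∑ x ∈ X, ∫⁻ z in copy D ε x, ‖f z - f x‖ₑ ^ p) := by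
          rw [← Finset.mul_sum, Finset.sum_add_distrib]
      _ ≤ 2 ^ (p - 1) * (η + η) := by
          gcongr
          · exact (hX.sum_setLIntegral_le hD hε hXΩ _).trans hfg
          · exact hosc X hX
      _ = 2 ^ (p - 1) * 2 * η := by ring
  have hcmp : ∀ x, copy D ε x ⊆ Ω → _ := fun x hx =>
    hcore.compare_copy hc hC hu hε (hg.mono_measure (Measure.restrict_mono hx le_rfl))
      (h.mono hx) (hfπ x)
  constructor
  · have hG : bmoG p D ⊥ α ε u Ω ≤
        θ * (κ * If + η) + T * η := by
      refine bmoG_le hε fun X hX hXΩ => ?_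
      calc ENNReal.ofReal (ε ^ ((n : ℝ) - p)) * ∑ x ∈ X, (α u (copy D ε x) : ℝ≥0∞)
          ≤ ∑ x ∈ X, (θ * (ENNReal.ofReal (ε ^ n) * a (f x)) +
              C * c * ∫⁻ z in copy D ε x, ‖g z - f x‖ₑ ^ p) := by
            rw [Finset.mul_sum]
            exact Finset.sum_le_sum fun x hx => (hcmp x (hXΩ x hx)).1
        _ = θ * (ENNReal.ofReal (ε ^ n) * ∑ x ∈ X, (a (f x) : ℝ≥0∞)) +
              C * c * ∑ x ∈ X, ∫⁻ z in copy D ε x, ‖g z - f x‖ₑ ^ p := by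
            simp only [Finset.sum_add_distrib, Finset.mul_sum]
        _ ≤ _ := by
            refine add_le_add (mul_le_mul_right (le_trans ?_ hpack) _) (herr X hX hXΩ)
            have hle : ∑ x ∈ X, (a (f x) : ℝ≥0∞) ≤ packSum D ε (fun x => (a (f x) : ℝ≥0∞)) :=
              le_iSup₂_of_le X hX le_rfl
            exact mul_le_mul_right hle _
    calc bmoG p D ⊥ α ε u Ω ≤ θ * (κ * If + η) + T * η := hG
      _ ≤ θ * (κ * (θ * Ig + V * η) + η) + T * η := by gcongr
      _ = θ * (θ * (κ * Ig)) + (θ * κ * V + θ + T) * η := by ring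
      _ ≤ θ * (θ * (κ * Ig)) + K * η := by
          gcongr
          rw [hK]
          calc θ * κ * V + θ + T ≤ θ * κ * V + θ + T + (κ * V + θ * T) :=
                le_self_add
            _ = _ := by ring
      _ ≤ _ := by
          rw [mul_comm K]
          exact add_le_add le_rfl hη.le
  · have hG : κ * If ≤ θ * bmoG p D ⊥ α ε u Ω + T * η := by
      obtain ⟨S, hS⟩ := has.isBounded.exists_norm_le
      refine (packConst_mul_lintegral_le D hε (by fun_prop) ⟨S, fun x hx => ?_⟩ haft).trans ?_
      · by_contra hne'
        refine absurd (hS x (subset_tsupport _ fun h0 => hne' ?_)) (not_le.2 hx)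
        exact_mod_cast h0
      rw [packSum, ENNReal.mul_iSup]
      refine iSup_le fun X => ?_
      rw [ENNReal.mul_iSup]
      refine iSup_le fun hX => ?_
      -- discard the centres outside the support of `f`
      set Y := X.filter fun x => x ∈ tsupport f with hY
      have hYX : ∑ x ∈ Y, (a (f x) : ℝ≥0∞) = ∑ x ∈ X, (a (f x) : ℝ≥0∞) := by
        refine Finset.sum_filter_of_ne fun x _ hx => ?_
        by_contra h0
        exact hx (by simp [image_eq_zero_of_notMem_tsupport h0, ha0])
      have hYp : IsPacking D ε Y := hX.subset fun x hx => (Finset.mem_filter.1 hx).1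
      have hYΩ : ∀ x ∈ Y, copy D ε x ⊆ Ω := fun x hx z hz => by
        refine hρ (Metric.mem_cthickening_of_dist_le z x ρ _ (Finset.mem_filter.1 hx).2 ?_)
        exact le_trans (by simpa using copy_subset_closedBall hR hε.le x hz) hερ.le
      rw [← hYX]
      calc ENNReal.ofReal (ε ^ n) * ∑ x ∈ Y, (a (f x) : ℝ≥0∞)
          ≤ ∑ x ∈ Y, (θ * (ENNReal.ofReal (ε ^ ((n : ℝ) - p)) * α u (copy D ε x)) +
              C * c * ∫⁻ z in copy D ε x, ‖g z - f x‖ₑ ^ p) := by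
            rw [Finset.mul_sum]
            exact Finset.sum_le_sum fun x hx => (hcmp x (hYΩ x hx)).2
        _ = θ * (ENNReal.ofReal (ε ^ ((n : ℝ) - p)) * ∑ x ∈ Y, (α u (copy D ε x) : ℝ≥0∞)) +
              C * c * ∑ x ∈ Y, ∫⁻ z in copy D ε x, ‖g z - f x‖ₑ ^ p := by
            simp only [Finset.sum_add_distrib, Finset.mul_sum]
        _ ≤ _ := add_le_add (mul_le_mul_right (hYp.le_bmoG hne hε hYΩ) _) (herr Y hYp hYΩ)
    calc κ * Ig
        ≤ κ * (θ * If + V * η) := by gcongr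
      _ = θ * (κ * If) + κ * V * η := by ring
      _ ≤ θ * (θ * bmoG p D ⊥ α ε u Ω + T * η) + κ * V * η := by gcongr
      _ = θ * (θ * bmoG p D ⊥ α ε u Ω) + (θ * T + κ * V) * η := by ring
      _ ≤ θ * (θ * bmoG p D ⊥ α ε u Ω) + K * η := by
          gcongr
          rw [hK]
          calc θ * T + κ * V ≤ θ * T + κ * V + (θ * κ * V + θ + T) := le_self_add
            _ = _ := by ring
      _ ≤ _ := by
          rw [mul_comm K]
          exact add_le_add le_rfl hη.le

/-- The same limit without `D ≠ ∅`. For `D = ∅` the packing constant may be infinite, but it is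
multiplied by `0`. -/
theorem IsStrongPCore.tendsto_bmoG (hα : IsStrongPCore p D ⊥ α)
    (hΩ : IsOpen Ω) (P : Submodule ℝ (Mat m n)) (hP : IsCompl P hα.isPCore.nullSpace)
    {u : Euc n → Euc m} (hu : LpLoc p univ u) {g : Euc n → Mat m n}
    (h : IsDistribD (P.projection hα.isPCore.nullSpace hP) Ω u g) (hg : LpOn p Ω g) :
    Tendsto (fun ε : ℝ => bmoG p D ⊥ α ε u Ω) (𝓝[>] 0)
      (𝓝 (packConst D * ∫⁻ x in Ω, (α (fun y => g x y) D : ℝ≥0∞))) := by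
  rcases D.eq_empty_or_nonempty with rfl | hne
  · have hlim : ∫⁻ x in Ω, (α (fun y => g x y) ∅ : ℝ≥0∞) = 0 := by
      simp [hα.isPCore.apply_eq_zero_of_empty (lpLoc_mat p (g _))]
    rw [hlim, mul_zero]
    refine tendsto_const_nhds.congr' ?_
    filter_upwards [self_mem_nhdsWithin] with ε (hε : 0 < ε)
    refine (le_antisymm (bmoG_le hε fun X _ _ => ?_) bot_le).symm
    simp [copy, hα.isPCore.apply_eq_zero_of_empty hu]
  · exact hα.tendsto_bmoG_of_nonempty hne hΩ P hP hu h hg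

/-! ### The limit density -/

theorem isOpen_unitCube (n : ℕ) : IsOpen (unitCube n) := by
  simp only [unitCube, ofPred_forall]
  exact isOpen_iInter_of_finite fun i => isOpen_Ioo.preimage (by fun_prop)

theorem volume_unitCube (n : ℕ) : volume (unitCube n) = 1 := by
  have h : unitCube n = (MeasurableEquiv.toLp 2 (Fin n → ℝ)).symm ⁻¹'
      (Set.pi univ fun _ => Ioo (-(1 / 2) : ℝ) (1 / 2)) := by
    ext x
    simp [unitCube]
  rw [h, (EuclideanSpace.volume_preserving_symm_measurableEquiv_toLp (Fin
    n)).measure_preimage_equiv, Real.volume_pi_Ioo]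
  norm_num

/-- The limit that defines `ψ_α`, as the case `u = l^A`, `D_π u = π A` of the general limit. -/
theorem IsStrongPCore.tendsto_bmoG_mat (hα : IsStrongPCore p D ⊥ α) (P : Submodule ℝ (Mat m n))
    (hP : IsCompl P hα.isPCore.nullSpace) (A : Mat m n) :
    Tendsto (fun ε : ℝ => bmoG p D ⊥ α ε (fun x => A x) (unitCube n)) (𝓝[>] 0)
      (𝓝 (packConst D * α (fun y => (P.projection hα.isPCore.nullSpace hP A) y) D)) := by
  have hfin : IsFiniteMeasure (volume.restrict (unitCube n)) :=
    ⟨by simp [volume_unitCube]⟩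
  have h := hα.tendsto_bmoG (isOpen_unitCube n) P hP (lpLoc_mat p A)
    (isDistribD_mat _ (unitCube n) A) (memLp_const _)
  rwa [setLIntegral_const, volume_unitCube, mul_one] at h

/-- The density `ψ_α` in closed form. -/
theorem IsStrongPCore.psi_eq (hα : IsStrongPCore p D ⊥ α) (P : Submodule ℝ (Mat m n))
    (hP : IsCompl P hα.isPCore.nullSpace) (A : Mat m n) :
    psi p D ⊥ α A =
      packConst D * α (fun y => (P.projection hα.isPCore.nullSpace hP A) y) D :=
  (hα.tendsto_bmoG_mat P hP A).limsup_eq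

theorem IsStrongPCore.psi_lt_top (hα : IsStrongPCore p D ⊥ α) (P : Submodule ℝ (Mat m n))
    (hP : IsCompl P hα.isPCore.nullSpace) (A : Mat m n) : psi p D ⊥ α A < ∞ := by
  rw [hα.psi_eq P hP]
  rcases D.eq_empty_or_nonempty with rfl | hne
  · simp [hα.isPCore.apply_eq_zero_of_empty (lpLoc_mat p _)]
  · exact ENNReal.mul_lt_top (packConst_ne_top hα.isPCore.isOpen_ref hα.isPCore.isBounded_ref
      hne).lt_top ENNReal.coe_lt_top

theorem IsStrongPCore.lintegral_psi (hα : IsStrongPCore p D ⊥ α) (hΩ : IsOpen Ω)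
    (P : Submodule ℝ (Mat m n)) (hP : IsCompl P hα.isPCore.nullSpace) {u : Euc n → Euc m}
    {g : Euc n → Mat m n} (h : IsDistribD (P.projection hα.isPCore.nullSpace hP) Ω u g) :
    ∫⁻ x in Ω, psi p D ⊥ α (g x) =
      packConst D * ∫⁻ x in Ω, (α (fun y => g x y) D : ℝ≥0∞) := by
  have hm : AEMeasurable (fun x => (α (fun y => g x y) D : ℝ≥0∞)) (volume.restrict Ω) :=
    (hα.isPCore.continuous_mat.comp_aestronglyMeasurable
      h.2.aestronglyMeasurable).aemeasurable.coe_nnreal_ennreal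
  rw [← lintegral_const_mul'' _ hm]
  refine lintegral_congr_ae ?_
  filter_upwards [h.ae_projection_eq hΩ] with x hx
  rw [hα.psi_eq P hP, hx]

/-- On a complement of its null space, the `p`-homogeneous continuous function `ψ` dominates
`|A|^p`. -/
theorem IsStrongPCore.exists_le_psi (hα : IsStrongPCore p D ⊥ α) (P : Submodule ℝ (Mat m n))
    (hP : IsCompl P hα.isPCore.nullSpace) :
    ∃ c : ℝ≥0, 0 < c ∧ ∀ A ∈ P, c * ‖A‖ₑ ^ p ≤ psi p D ⊥ α A := by
  have hp0 : 0 < p := zero_lt_one.trans_le hα.isPCore.one_le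
  have : ProperSpace (Mat m n) := FiniteDimensional.proper ℝ _
  set q : Mat m n → ℝ≥0 := fun A =>
    (packConst D).toNNReal * α (fun y => (P.projection hα.isPCore.nullSpace hP A) y) D with hq
  have hqψ : ∀ A, (q A : ℝ≥0∞) = psi p D ⊥ α A := fun A => by
    rw [← ENNReal.coe_toNNReal (hα.psi_lt_top P hP A).ne, hα.psi_eq P hP, ENNReal.toNNReal_mul,
      ENNReal.toNNReal_coe]
  have hqc : Continuous q := continuous_const.mul (hα.isPCore.continuous_mat.comp
    (P.projection hα.isPCore.nullSpace hP).toContinuousLinearMap.continuous)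
  have hK : IsCompact (Metric.sphere (0 : Mat m n) 1 ∩ P) :=
    (isCompact_sphere _ _).inter_right P.closed_of_finiteDimensional
  obtain ⟨c, hc0, hc⟩ := hK.exists_forall_le' hqc.continuousOn (a := 0) fun A hA => by
    rw [pos_iff_ne_zero]
    intro h0
    have h1 : A ∈ hα.isPCore.nullSpace := by
      change psi p D ⊥ α A = 0
      rw [← hqψ, h0, ENNReal.coe_zero]
    have h2 : A = 0 := by simpa using hP.disjoint.le_bot ⟨hA.2, h1⟩
    simpa [h2] using hA.1
  refine ⟨c, hc0, fun A hA => ?_⟩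
  by_cases hA0 : A = 0
  · have h0 : ‖A‖ₑ = 0 := by rw [← ofReal_norm, hA0, norm_zero, ENNReal.ofReal_zero]
    rw [h0, ENNReal.zero_rpow_of_pos hp0, mul_zero]
    exact bot_le
  have hpos : 0 < ‖A‖ := norm_pos_iff.2 hA0
  set B : Mat m n := ‖A‖⁻¹ • A with hB
  have hAB : A = ‖A‖ • B := by
    rw [hB]
    exact (smul_inv_smul₀ hpos.ne' A).symm
  have hBK : B ∈ Metric.sphere (0 : Mat m n) 1 ∩ P := by
    refine ⟨?_, P.smul_mem _ hA⟩
    rw [mem_sphere_zero_iff_norm, hB, norm_smul, norm_inv, norm_norm, inv_mul_cancel₀ hpos.ne']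
  have hψ : psi p D ⊥ α A = ‖A‖ₑ ^ p * psi p D ⊥ α B := by
    rw [hα.psi_eq P hP, hα.psi_eq P hP B]
    nth_rw 1 [hAB]
    rw [map_smul, hα.isPCore.smul_mat_ref hpos, ofReal_norm]
    ring
  rw [hψ, mul_comm]
  gcongr
  rw [← hqψ]
  exact_mod_cast hc B hBK

theorem _root_.IsOpen.exists_isCompact_lt_setLIntegral (hΩ : IsOpen Ω) {f : Euc n → ℝ≥0∞}
    {M : ℝ≥0∞} (hM : M < ∫⁻ x in Ω, f x) : ∃ K ⊆ Ω, IsCompact K ∧ M < ∫⁻ x in K, f x := by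
  obtain ⟨F, hF, hFΩ, hU, hmono⟩ := hΩ.exists_iUnion_isClosed
  set K : ℕ → Set (Euc n) := fun k => F k ∩ Metric.closedBall 0 k with hK
  have hKm : Monotone K := fun i j hij => inter_subset_inter (hmono hij)
    (Metric.closedBall_subset_closedBall (by exact_mod_cast hij))
  have hKU : ⋃ k, K k = Ω := by
    rw [hK, iUnion_inter_of_monotone hmono, hU, Metric.iUnion_closedBall_nat, inter_univ]
    exact fun i j hij => Metric.closedBall_subset_closedBall (by exact_mod_cast hij)
  rw [← hKU, setLIntegral_iUnion_of_directed _ hKm.directed_le, lt_iSup_iff] at hM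
  obtain ⟨k, hk⟩ := hM
  exact ⟨K k, inter_subset_left.trans (hFΩ k),
    (isCompact_closedBall _ _).inter_left (hF k), hk⟩

/-- If `∫ ψ(g)` is finite, then `g ∈ L^p(Ω)` by coercivity of `ψ` on `P`; if it is infinite, the
seminorms on relatively compact open subsets of `Ω` already have arbitrarily large limits. -/
theorem IsStrongPCore.tendsto_bmoG_of_isWLpLoc (hα : IsStrongPCore p D ⊥ α) (hΩ : IsOpen Ω)
    (P : Submodule ℝ (Mat m n)) (hP : IsCompl P hα.isPCore.nullSpace) {u : Euc n → Euc m}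
    (hu : LpLoc p univ u) {g : Euc n → Mat m n}
    (h : IsWLpLoc (P.projection hα.isPCore.nullSpace hP) p Ω u g) :
    Tendsto (fun ε : ℝ => bmoG p D ⊥ α ε u Ω) (𝓝[>] 0)
      (𝓝 (∫⁻ x in Ω, psi p D ⊥ α (g x))) := by
  have hp0 : 0 < p := zero_lt_one.trans_le hα.isPCore.one_le
  have hg := h.isDistribD
  by_cases hI : ∫⁻ x in Ω, psi p D ⊥ α (g x) = ∞
  · rw [hI, ENNReal.tendsto_nhds_top_iff_nnreal]
    intro M
    obtain ⟨K, hKΩ, hK, hMK⟩ := hΩ.exists_isCompact_lt_setLIntegral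
      (hI ▸ ENNReal.coe_lt_top : (M : ℝ≥0∞) < _)
    obtain ⟨L, hL, hKL, hLΩ⟩ := exists_compact_between hK hΩ hKΩ
    have hV : interior L ⊆ Ω := interior_subset.trans hLΩ
    have hgV := hg.mono hV
    have hlim := hα.tendsto_bmoG isOpen_interior P hP hu hgV
      ((h.lpLoc_deriv L hL hLΩ).mono_measure (Measure.restrict_mono interior_subset le_rfl))
    rw [← hα.lintegral_psi isOpen_interior P hP hgV] at hlim
    filter_upwards [hlim.eventually
      (lt_mem_nhds (hMK.trans_le (lintegral_mono_set hKL)))] with ε hε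
    exact hε.trans_le (bmoG_mono hV ε u)
  · obtain ⟨c, hc0, hc⟩ := hα.exists_le_psi P hP
    rw [hα.lintegral_psi hΩ P hP hg]
    refine hα.tendsto_bmoG hΩ P hP hu hg ⟨hg.2.aestronglyMeasurable, ?_⟩
    rw [eLpNorm_lt_top_iff_lintegral_rpow_enorm_lt_top (by simpa using hp0)
      ENNReal.ofReal_ne_top, ENNReal.toReal_ofReal hp0.le]
    have hle : c * ∫⁻ x in Ω, ‖g x‖ₑ ^ p ≤ ∫⁻ x in Ω, psi p D ⊥ α (g x) := by
      rw [← lintegral_const_mul' _ _ ENNReal.coe_ne_top]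
      refine lintegral_mono_ae ?_
      filter_upwards [hg.ae_projection_eq hΩ] with x hx
      refine hc (g x) ?_
      rw [← hx]
      exact Submodule.projection_apply_mem hP _
    refine lt_top_iff_ne_top.2 fun htop => hI (top_le_iff.1 ?_)
    rwa [htop, ENNReal.mul_top (by exact_mod_cast hc0.ne')] at hle

end BMOType

end

theorem theorem1p2 {m n : ℕ} (hm : 1 ≤ m) {p : ℝ} (hp : 1 ≤ p)
    {Ω D : Set (BMOType.Euc n)} (hΩ : IsOpen Ω) (hD : IsOpen D) (hDb : Bornology.IsBounded D)
    {α : (BMOType.Euc n → BMOType.Euc m) → Set (BMOType.Euc n) → ℝ≥0}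
    (hα : BMOType.IsStrongPCore p D ⊥ α)
    (P : Submodule ℝ (BMOType.Mat m n)) (hP : IsCompl P hα.isPCore.nullSpace)
    {u : BMOType.Euc n → BMOType.Euc m} (hu : BMOType.LpLoc p univ u) :
    -- the limit that defines `ψ_α` exists and is finite
    (∀ A : BMOType.Mat m n, BMOType.psi p D ⊥ α A < ∞ ∧
      Tendsto (fun ε : ℝ => BMOType.bmoG p D ⊥ α ε (fun x => A x) (BMOType.unitCube n))
        (𝓝[>] 0) (𝓝 (BMOType.psi p D ⊥ α A))) ∧
    -- the case `D_{π_P} (u|_Ω) = g ∈ L^p(Ω)`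
    (∀ g : BMOType.Euc n → BMOType.Mat m n,
      BMOType.IsDistribD (P.projection hα.isPCore.nullSpace hP) Ω u g → BMOType.LpOn p Ω g →
      Tendsto (fun ε : ℝ => BMOType.bmoG p D ⊥ α ε u Ω) (𝓝[>] 0)
        (𝓝 (∫⁻ x in Ω, BMOType.psi p D ⊥ α (g x)))) ∧
    -- the case `u|_Ω ∈ W^{π_P,p}_loc(Ω)`, `D_{π_P} (u|_Ω) = g`, and `ψ_α` not identically zero
    ((∃ A : BMOType.Mat m n, BMOType.psi p D ⊥ α A ≠ 0) →
      ∀ g : BMOType.Euc n → BMOType.Mat m n,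
        BMOType.IsWLpLoc (P.projection hα.isPCore.nullSpace hP) p Ω u g →
        Tendsto (fun ε : ℝ => BMOType.bmoG p D ⊥ α ε u Ω) (𝓝[>] 0)
          (𝓝 (∫⁻ x in Ω, BMOType.psi p D ⊥ α (g x)))) := by
  refine ⟨fun A => ⟨hα.psi_lt_top P hP A, ?_⟩, fun g h hg => ?_, fun _ g h =>
    hα.tendsto_bmoG_of_isWLpLoc hΩ P hP hu h⟩
  · rw [hα.psi_eq P hP]
    exact hα.tendsto_bmoG_mat P hP A
  · rw [hα.lintegral_psi hΩ P hP h]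
    exact hα.tendsto_bmoG hΩ P hP hu h hg
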